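/- Let $k$ be a field of characteristic different from $2$ and $3$, let $\Gamma$ be an abelian group, and let $\varepsilon:\Gamma\times\Gamma\to k\setminus\{0\}$ be a commutation factor, that is, $\varepsilon$ is multiplicative in each argument and $\varepsilon(\alpha,\beta)\varepsilon(\beta,\alpha)=1$. Let $g=\bigoplus_{\gamma\in\Gamma}g_\gamma$ be a finite-dimensional color Lie algebra over $k$: a $\Gamma$-graded vector space with a bilinear bracket such that, for $a\in g_\alpha$, $b\in g_\beta$, $c\in g_\gamma$, $$\langle a,b\rangle\in g_{\alpha+\beta},\qquad \langle a,b\rangle=-\varepsilon(\alpha,\beta)\langle b,a\rangle,$$ $$\varepsilon(\gamma,\alpha)\langle a,\langle b,c\rangle\rangle+\varepsilon(\beta,\gamma)\langle c,\langle a,b\rangle\rangle+\varepsilon(\alpha,\beta)\langle b,\langle c,a\rangle\rangle=0.$$ Let $R\subset g\oplus(g\otimes g)\subset T(g)$ be the linear span of the elements $a\otimes b-\varepsilon(\alpha,\beta)\,b\otimes a-\langle a,b\rangle$ with $a\in g_\alpha$, $b\in g_\beta$, let $I$ be the two-sided ideal of $T(g)$ generated by $R$, and let $U(g)=T(g)/I$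 be the universal enveloping algebra. Write $U(g)^0$ for the quotient of $T(g)$ by the ideal generated by the projection of $R$ on $g\otimes g$, and $\operatorname{gr}U(g)$ for the associated graded algebra of $U(g)$ with respect to the filtration by total degree in $g$. A graded algebra $B=\bigoplus_{m\ge0}B_m$ with finite-dimensional components, $B_0=k$, and generated by $B_1$ is called Koszul if the trivial graded right module $B/B_+$ has a linear free resolution, that is, a graded free resolution whose $i$-th term is free of finite rank with generators in degree $i$. Then: 1. $U(g)$ is almost quadratic with space of generators $g$ and space of relations $R$: the map $g\to U(g)$ is injective, $U(g)$ has an augmentation $U(g)\to k$ whose kernel is the two-sided ideal generated by $g$, and $U(g)=T(g)/(R)$ with $R\subset g\oplus (g\otimes g)$. 2. $U(g)$ is a PBW algebra: for some bases $v_1,\dots,v_n$ of $g$ and $r_1,\dots,r_m$ of $R$, the set $\{r_1,\dots,r_m\}$ is a Gröbner basis of $I$ for the degree-lexicographical order with $v_1>\dots>v_n$. More precisely, for every basis $v_1,\dots,v_n$ of $g$ consisting of homogeneous elements, $v_i\in g_{\gamma_i}$, the elements $$v_iv_j-\varepsilon(\gamma_i,\gamma_j)\,v_jv_i-\langle v_i,v_j\rangle\qquad(i<j,\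 \text{or } i=j \text{ and } \varepsilon(\gamma_i,\gamma_i)=-1)$$ form a basis of $R$ and a Gröbner basis of $I$ for this order. 3. $U(g)$ is a (nonhomogeneous) Koszul algebra: the graded algebras $U(g)^0$ and $\operatorname{gr}U(g)$ are isomorphic, by an isomorphism of graded algebras that is the identity on $g$, and both are Koszul. 4. Let $g_{\mathrm{ab}}$ be the abelian color Lie algebra (zero bracket) with the same graded vector space and the same commutation factor as $g$. Then $\operatorname{gr}U(g)$ and $U(g)^0$ are isomorphic to $U(g_{\mathrm{ab}})$ as graded algebras, by isomorphisms that are the identity on $g$, where $U(g_{\mathrm{ab}})$ is graded by total degree in $g$. -/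

import Mathlib

open scoped DirectSum

/-! ### Commutation factors and color Lie algebras -/

/-- A commutation factor on the abelian group `Γ` with values in `k \ {0}`. -/
structure CommutationFactor (k Γ : Type*) [Field k] [AddCommGroup Γ] where
  toFun : Γ → Γ → kˣ
  add_left : ∀ α β γ, toFun (α + β) γ = toFun α γ * toFun β γ
  add_right : ∀ α β γ, toFun α (β + γ) = toFun α β * toFun α γ
  mul_swap : ∀ α β, toFun α β * toFun β α = 1

instance {k Γ : Type*} [Field k] [AddCommGroup Γ] :
    CoeFun (CommutationFactor k Γ) (fun _ => Γ → Γ → kˣ) := ⟨CommutationFactor.toFun⟩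

/-- The structure of a `Γ`-graded `ε`-Lie algebra (color Lie algebra) on the vector space `g`. -/
structure ColorLieAlgebra {k Γ : Type*} [Field k] [AddCommGroup Γ] (ε : CommutationFactor k Γ)
    (g : Type*) [AddCommGroup g] [Module k g] where
  /-- the homogeneous components -/
  comp : Γ → Submodule k g
  /-- the space is the (internal) direct sum of its components -/
  comp_indep : iSupIndep comp
  comp_iSup : ⨆ γ, comp γ = ⊤
  /-- the bracket -/
  bracket : g →ₗ[k] g →ₗ[k] g
  bracket_mem : ∀ {α β : Γ} {a b : g}, a ∈ comp α → b ∈ comp β → bracket a b ∈ comp (α + β)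
  bracket_skew : ∀ {α β : Γ} {a b : g}, a ∈ comp α → b ∈ comp β →
    bracket a b = -((ε α β : k) • bracket b a)
  jacobi : ∀ {α β γ : Γ} {a b c : g}, a ∈ comp α → b ∈ comp β → c ∈ comp γ →
    (ε γ α : k) • bracket a (bracket b c) + (ε β γ : k) • bracket c (bracket a b)
      + (ε α β : k) • bracket b (bracket c a) = 0

namespace ColorLieAlgebra

variable {k Γ : Type*} [Field k] [AddCommGroup Γ] {ε : CommutationFactor k Γ}
  {g : Type*} [AddCommGroup g] [Module k g] (L : ColorLieAlgebra ε g)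

/-- The abelian color Lie algebra on the same graded space, with the same commutation factor. -/
def abelian : ColorLieAlgebra ε g where
  comp := L.comp
  comp_indep := L.comp_indep
  comp_iSup := L.comp_iSup
  bracket := 0
  bracket_mem _ _ := by simp
  bracket_skew _ _ := by simp
  jacobi _ _ _ := by simp

/-- The element `a b - ε(α, β) b a - ⟨a, b⟩` of the tensor algebra. -/
noncomputable def commRel (α β : Γ) (a b : g) : TensorAlgebra k g :=
  TensorAlgebra.ι k a * TensorAlgebra.ι k b
    - (ε α β : k) • (TensorAlgebra.ι k b * TensorAlgebra.ι k a)
    - TensorAlgebra.ι k (L.bracket a b)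

/-- The space of defining relations of the universal enveloping algebra. -/
noncomputable def relations : Submodule k (TensorAlgebra k g) :=
  Submodule.span k {x | ∃ α β : Γ, ∃ a ∈ L.comp α, ∃ b ∈ L.comp β, x = L.commRel α β a b}

/-- The relations `ab = ε(α, β) ba + ⟨a, b⟩` for homogeneous `a`, `b`. -/
inductive EnvRel : TensorAlgebra k g → TensorAlgebra k g → Prop
  | comm {α β : Γ} {a b : g} (ha : a ∈ L.comp α) (hb : b ∈ L.comp β) :
      EnvRel (TensorAlgebra.ι k a * TensorAlgebra.ι k b)
        ((ε α β : k) • (TensorAlgebra.ι k b * TensorAlgebra.ι k a)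
          + TensorAlgebra.ι k (L.bracket a b))

/-- The universal enveloping algebra `U(g)`. -/
abbrev Env := RingQuot L.EnvRel

/-- The canonical map `g → U(g)`. -/
noncomputable def envι : g →ₗ[k] L.Env :=
  (RingQuot.mkAlgHom k L.EnvRel).toLinearMap ∘ₗ TensorAlgebra.ι k

/-- For a basis `b` of homogeneous elements of degrees `deg`, the pairs `i < j`, together with the
pairs `i = j` for which `ε(deg i, deg i) = -1`. For the other diagonal pairs the relation
`b i b i - ε b i b i - ⟨b i, b i⟩` is zero in characteristic different from `2`. -/
abbrev RelIndex (ε : CommutationFactor k Γ) {n : ℕ} (deg : Fin n → Γ) : Type :=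
  {p : Fin n × Fin n // p.1 < p.2 ∨ (p.1 = p.2 ∧ (ε (deg p.1) (deg p.1) : k) = -1)}

/-- The defining relations `b i b j - ε(deg i, deg j) b j b i - ⟨b i, b j⟩` attached to a
homogeneous basis. -/
noncomputable def basisRel {n : ℕ} (b : Module.Basis (Fin n) k g) (deg : Fin n → Γ) :
    RelIndex ε deg → TensorAlgebra k g :=
  fun p => L.commRel (deg p.1.1) (deg p.1.2) (b p.1.1) (b p.1.2)

end ColorLieAlgebra

/-! ### Groebner bases in the tensor algebra -/

section Groebner

variable {k V : Type*} [Field k] [AddCommGroup V] [Module k V] {n : ℕ}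

/-- The degree-lexicographical order on words in `v_0, …, v_{n-1}` with `v_0 > ⋯ > v_{n-1}`. -/
def DegLexLT (u w : FreeMonoid (Fin n)) : Prop :=
  List.Shortlex (fun i j : Fin n => j < i) u.toList w.toList

/-- `w` is the leading monomial of `f`, monomials being taken in the basis `b` of `V`. -/
def IsLeadingMonomial (b : Module.Basis (Fin n) k V) (f : TensorAlgebra k V)
    (w : FreeMonoid (Fin n)) : Prop :=
  w ∈ (b.tensorAlgebra.repr f).support ∧
    ∀ u ∈ (b.tensorAlgebra.repr f).support, u ≠ w → DegLexLT u w

/-- `r` is a Groebner basis of the two-sided ideal `I` for the degree-lexicographical order: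
`r` is a subset of `I` and the leading monomial of each nonzero element of `I` contains the leading
monomial of some element of `r` as a subword. -/
def IsGroebnerBasis (b : Module.Basis (Fin n) k V) (r : Set (TensorAlgebra k V))
    (I : TwoSidedIdeal (TensorAlgebra k V)) : Prop :=
  (∀ f ∈ r, f ∈ I) ∧
    ∀ f ∈ I, f ≠ 0 → ∃ w, IsLeadingMonomial b f w ∧
      ∃ h ∈ r, ∃ t, IsLeadingMonomial b h t ∧ ∃ p q, w = p * t * q

end Groebner

/-! ### Graded algebras and homogeneous Koszulity -/

section Koszul

variable {k A : Type*} [Field k] [Ring A] [Algebra k A]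

/-- `𝒜` is a grading of `A` that makes `A` a standard algebra: finite-dimensional components,
degree-zero component `k`, generated by the degree-one component. -/
structure IsStandard (𝒜 : ℕ → Submodule k A) : Prop where
  indep : iSupIndep 𝒜
  iSup_eq_top : ⨆ m, 𝒜 m = ⊤
  mul_mem : ∀ {i j : ℕ} {x y : A}, x ∈ 𝒜 i → y ∈ 𝒜 j → x * y ∈ 𝒜 (i + j)
  finite : ∀ m, Module.Finite k (𝒜 m)
  nontrivial : Nontrivial A
  zero_eq : 𝒜 0 = 1
  generated : Algebra.adjoin k (𝒜 1 : Set A) = ⊤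

/-- The right module `M`, graded by `ℳ`, over the algebra `A`, graded by `𝒜`, has a linear free
resolution `⋯ → F₁ → F₀ → M → 0`: here `F i = (I i → A)` is the free graded right module of finite
rank with generators in degree `d + i`, so a vector with entries in `𝒜 m` has degree `d + i + m`;
all maps are right linear and preserve degrees. -/
def HasLinearFreeResolution (𝒜 : ℕ → Submodule k A) {M : Type*} [AddCommGroup M]
    [Module Aᵐᵒᵖ M] (ℳ : ℕ → AddSubgroup M) (d : ℕ) : Prop :=
  ∃ (I : ℕ → Type) (_ : ∀ i, Finite (I i))
    (π : (I 0 → A) →ₗ[Aᵐᵒᵖ] M)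
    (δ : ∀ i, (I (i + 1) → A) →ₗ[Aᵐᵒᵖ] (I i → A)),
    (∀ (m : ℕ) (x : I 0 → A), (∀ q, x q ∈ 𝒜 m) → π x ∈ ℳ (d + m)) ∧
    (∀ (i m : ℕ) (x : I (i + 1) → A), (∀ q, x q ∈ 𝒜 m) → ∀ p, δ i x p ∈ 𝒜 (m + 1)) ∧
    Function.Surjective π ∧ Function.Exact (δ 0) π ∧ ∀ i, Function.Exact (δ (i + 1)) (δ i)

/-- The augmentation ideal `A₊` of a graded algebra, as a right ideal. -/
def augRightIdeal (𝒜 : ℕ → Submodule k A) : Submodule Aᵐᵒᵖ A :=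
  Submodule.span Aᵐᵒᵖ {x | ∃ m, 0 < m ∧ x ∈ 𝒜 m}

/-- The standard algebra `A`, graded by `𝒜`, is (homogeneous) Koszul: the trivial right module
`A / A₊`, with the grading induced from `A`, has a linear free resolution with generator in
degree `0`. -/
def IsHomogeneousKoszul (𝒜 : ℕ → Submodule k A) : Prop :=
  IsStandard 𝒜 ∧
    HasLinearFreeResolution 𝒜 (M := A ⧸ augRightIdeal 𝒜)
      (fun m => (𝒜 m).toAddSubgroup.map (augRightIdeal 𝒜).mkQ.toAddMonoidHom) 0

/-- `A` and `B`, with generating maps from `V`, are isomorphic as graded algebras, by an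
isomorphism that is the identity on `V`. -/
def GradedIso {B V : Type*} [Ring B] [Algebra k B] [AddCommGroup V] [Module k V]
    (𝒜 : ℕ → Submodule k A) (ℬ : ℕ → Submodule k B) (genA : V → A) (genB : V → B) : Prop :=
  ∃ e : A ≃ₐ[k] B, (∀ v, e (genA v) = genB v) ∧ ∀ m, (𝒜 m).map e.toLinearMap = ℬ m

end Koszul

/-! ### The associated graded algebra of an algebra with a given space of generators -/

namespace GenFilt

variable {k A : Type*} [Field k] [Ring A] [Algebra k A] (W : Submodule k A)

/-- Elements which are polynomials of degree at most `m` in elements of `W`. -/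
def le (m : ℕ) : Submodule k A := ⨆ j, ⨆ (_ : j ≤ m), W ^ j

/-- Elements which are polynomials of degree less than `m` in elements of `W`. -/
def lt (m : ℕ) : Submodule k A := ⨆ j, ⨆ (_ : j < m), W ^ j

theorem pow_le_le {j m : ℕ} (h : j ≤ m) : W ^ j ≤ le W m :=
  le_iSup₂_of_le j h le_rfl

theorem pow_le_lt {j m : ℕ} (h : j < m) : W ^ j ≤ lt W m :=
  le_iSup₂_of_le j h le_rfl

theorem le_mul_le (i j : ℕ) : le W i * le W j ≤ le W (i + j) := by
  simp only [le, Submodule.iSup_mul, Submodule.mul_iSup, iSup_le_iff]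
  intro a ha b hb
  rw [← pow_add]
  exact pow_le_le W (by omega)

theorem lt_mul_le (i j : ℕ) : lt W i * le W j ≤ lt W (i + j) := by
  simp only [le, lt, Submodule.iSup_mul, Submodule.mul_iSup, iSup_le_iff]
  intro a ha b hb
  rw [← pow_add]
  exact pow_le_lt W (by omega)

theorem le_mul_lt (i j : ℕ) : le W i * lt W j ≤ lt W (i + j) := by
  simp only [le, lt, Submodule.iSup_mul, Submodule.mul_iSup, iSup_le_iff]
  intro a ha b hb
  rw [← pow_add]
  exact pow_le_lt W (by omega)

/-- The component `F_m / F_{m-1}` of the associated graded algebra. -/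
def Comp (m : ℕ) : Type _ := le W m ⧸ (lt W m).comap (le W m).subtype

instance (m : ℕ) : AddCommGroup (Comp W m) :=
  inferInstanceAs (AddCommGroup (le W m ⧸ (lt W m).comap (le W m).subtype))

instance (m : ℕ) : Module k (Comp W m) :=
  inferInstanceAs (Module k (le W m ⧸ (lt W m).comap (le W m).subtype))

/-- The class in `F_m / F_{m-1}` of an element of `F_m`. -/
def cls (m : ℕ) : le W m →ₗ[k] Comp W m :=
  ((lt W m).comap (le W m).subtype).mkQ

theorem cls_surjective (m : ℕ) : Function.Surjective (cls W m) :=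
  Submodule.mkQ_surjective _

theorem cls_eq_zero {m : ℕ} {x : le W m} : cls W m x = 0 ↔ (x : A) ∈ lt W m :=
  Submodule.Quotient.mk_eq_zero _

/-- The product of representatives. -/
def mulRep (i j : ℕ) : le W i →ₗ[k] le W j →ₗ[k] le W (i + j) :=
  LinearMap.mk₂ k (fun x y => ⟨x * y, le_mul_le W i j (Submodule.mul_mem_mul x.2 y.2)⟩)
    (fun _ _ _ => Subtype.ext (add_mul _ _ _)) (fun _ _ _ => Subtype.ext (smul_mul_assoc _ _ _))
    (fun _ _ _ => Subtype.ext (mul_add _ _ _)) (fun _ _ _ => Subtype.ext (mul_smul_comm _ _ _))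

/-- Multiplication by a representative from the left, `F_j / F_{j-1} → F_{i+j} / F_{i+j-1}`. -/
def mulLeft (i j : ℕ) (x : le W i) : Comp W j →ₗ[k] Comp W (i + j) :=
  Submodule.liftQ _ (cls W (i + j) ∘ₗ mulRep W i j x) (fun _ hy =>
    (cls_eq_zero W).2 (le_mul_lt W i j (Submodule.mul_mem_mul x.2 hy)))

theorem mulLeft_cls (i j : ℕ) (x : le W i) (y : le W j) :
    mulLeft W i j x (cls W j y) = cls W (i + j) (mulRep W i j x y) := rfl

/-- The multiplication `F_i / F_{i-1} × F_j / F_{j-1} → F_{i+j} / F_{i+j-1}`, induced by the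
multiplication of representatives. -/
def mulCls (i j : ℕ) : Comp W i →ₗ[k] Comp W j →ₗ[k] Comp W (i + j) :=
  Submodule.liftQ _
    { toFun := mulLeft W i j
      map_add' := fun x x' => by
        ext y
        obtain ⟨y, rfl⟩ := cls_surjective W j y
        simp [mulLeft_cls]
      map_smul' := fun c x => by
        ext y
        obtain ⟨y, rfl⟩ := cls_surjective W j y
        simp [mulLeft_cls] }
    (fun x hx => by
      ext y
      obtain ⟨y, rfl⟩ := cls_surjective W j y
      exact (cls_eq_zero W).2 (lt_mul_le W i j (Submodule.mul_mem_mul hx y.2)))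

theorem mulCls_cls (i j : ℕ) (x : le W i) (y : le W j) :
    mulCls W i j (cls W i x) (cls W j y) = cls W (i + j) (mulRep W i j x y) := rfl

theorem one_mem_le (m : ℕ) : (1 : A) ∈ le W m :=
  pow_le_le W (Nat.zero_le m) (by rw [pow_zero]; exact Submodule.one_le.1 le_rfl)

theorem mk_cls_eq {i j : ℕ} (h : i = j) (x : le W i) (y : le W j) (hxy : (x : A) = y) :
    GradedMonoid.mk (A := Comp W) i (cls W i x) = GradedMonoid.mk j (cls W j y) := by
  subst h
  rw [Subtype.ext hxy]

instance : GradedMonoid.GMul (Comp W) := ⟨fun {i j} x y => mulCls W i j x y⟩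

instance : GradedMonoid.GOne (Comp W) := ⟨cls W 0 ⟨1, one_mem_le W 0⟩⟩

instance gring : DirectSum.GRing (Comp W) where
  mul_zero a := map_zero (mulCls W _ _ a)
  zero_mul b := LinearMap.map_zero₂ (mulCls W _ _) b
  mul_add a b c := map_add (mulCls W _ _ a) b c
  add_mul a b c := LinearMap.map_add₂ (mulCls W _ _) a b c
  one_mul := by
    rintro ⟨i, x⟩
    obtain ⟨x, rfl⟩ := cls_surjective W i x
    exact mk_cls_eq W (zero_add i) _ x (one_mul (x : A))
  mul_one := by
    rintro ⟨i, x⟩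
    obtain ⟨x, rfl⟩ := cls_surjective W i x
    exact mk_cls_eq W (add_zero i) _ x (mul_one (x : A))
  mul_assoc := by
    rintro ⟨i, x⟩ ⟨j, y⟩ ⟨l, z⟩
    obtain ⟨x, rfl⟩ := cls_surjective W i x
    obtain ⟨y, rfl⟩ := cls_surjective W j y
    obtain ⟨z, rfl⟩ := cls_surjective W l z
    exact mk_cls_eq W (add_assoc i j l) _ _ (mul_assoc (x : A) y z)
  natCast c := c • cls W 0 ⟨1, one_mem_le W 0⟩
  natCast_zero := zero_smul _ _
  natCast_succ c := succ_nsmul _ c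
  intCast c := c • cls W 0 ⟨1, one_mem_le W 0⟩
  intCast_ofNat c := natCast_zsmul _ c
  intCast_negSucc_ofNat c := negSucc_zsmul _ c

instance galgebra : DirectSum.GAlgebra k (Comp W) where
  toFun :=
    { toFun := fun c => c • cls W 0 ⟨1, one_mem_le W 0⟩
      map_zero' := zero_smul _ _
      map_add' := fun _ _ => add_smul _ _ _ }
  map_one := one_smul _ _
  map_mul c c' := by
    refine mk_cls_eq W (zero_add 0).symm ((c * c') • ⟨1, one_mem_le W 0⟩)
      (mulRep W 0 0 (c • ⟨1, one_mem_le W 0⟩) (c' • ⟨1, one_mem_le W 0⟩)) ?_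
    simp [mulRep, mul_smul, smul_comm c c']
  commutes c := by
    rintro ⟨i, x⟩
    obtain ⟨x, rfl⟩ := cls_surjective W i x
    refine mk_cls_eq W ((zero_add i).trans (add_zero i).symm)
      (mulRep W 0 i (c • ⟨1, one_mem_le W 0⟩) x) (mulRep W i 0 x (c • ⟨1, one_mem_le W 0⟩)) ?_
    simp [mulRep]
  smul_def c := by
    rintro ⟨i, x⟩
    obtain ⟨x, rfl⟩ := cls_surjective W i x
    refine mk_cls_eq W (zero_add i).symm (c • x) (mulRep W 0 i (c • ⟨1, one_mem_le W 0⟩) x) ?_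
    simp [mulRep]

/-- The associated graded algebra `⨁ F_m / F_{m-1}` of `A`, filtered by total degree in `W`. -/
abbrev Gr := ⨁ m, Comp W m

/-- The homogeneous components of the associated graded algebra. -/
noncomputable def grading (m : ℕ) : Submodule k (Gr W) :=
  LinearMap.range (DirectSum.lof k ℕ (Comp W) m)

/-- The class in degree one of an element of `W`. -/
noncomputable def grOf (x : W) : Gr W :=
  DirectSum.lof k ℕ (Comp W) 1
    (cls W 1 ⟨x, pow_le_le W le_rfl (by rw [pow_one]; exact x.2)⟩)

end GenFilt

/-! ### Almost quadratic algebras -/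

section AlmostQuadratic

variable {k A V : Type*} [Field k] [Ring A] [Algebra k A] [AddCommGroup V] [Module k V]

/-- The homogeneous component `V ⊗ ⋯ ⊗ V` of degree `m` of the tensor algebra. -/
abbrev tensorDeg (k V : Type*) [Field k] [AddCommGroup V] [Module k V] (m : ℕ) :
    Submodule k (TensorAlgebra k V) :=
  LinearMap.range (TensorAlgebra.ι k : V →ₗ[k] TensorAlgebra k V) ^ m

/-- `A` is an almost quadratic algebra with the finite-dimensional space of generators `V`,
embedded by `gen`, and with the space of relations `rel ⊆ V ⊕ V ⊗ V`: it is augmented, with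
augmentation ideal generated by `V`, and the canonical map `T(V) → A` is surjective with kernel
generated by `rel`. -/
structure IsAlmostQuadratic (gen : V →ₗ[k] A) (rel : Submodule k (TensorAlgebra k V)) : Prop where
  finite : Module.Finite k V
  gen_injective : Function.Injective gen
  augmented : ∃ aug : A →ₐ[k] k, TwoSidedIdeal.ker aug = TwoSidedIdeal.span (Set.range gen)
  rel_le : rel ≤ tensorDeg k V 1 ⊔ tensorDeg k V 2
  surjective : Function.Surjective (TensorAlgebra.lift k gen)
  ker_eq : TwoSidedIdeal.ker (TensorAlgebra.lift k gen) = TwoSidedIdeal.span (rel : Set _)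

/-- `f = 0` for `f` in the projection of `rel ⊆ V ⊕ V ⊗ V` on `V ⊗ V`. -/
def quadRel (rel : Submodule k (TensorAlgebra k V)) (f f' : TensorAlgebra k V) : Prop :=
  f ∈ tensorDeg k V 2 ∧ (∃ l ∈ tensorDeg k V 1, f + l ∈ rel) ∧ f' = 0

/-- The homogeneous quadratic algebra `A⁰` of an almost quadratic algebra: the quotient of `T(V)`
by the ideal generated by the projection of the relations on `V ⊗ V`. -/
abbrev QuadAlg (rel : Submodule k (TensorAlgebra k V)) := RingQuot (quadRel rel)

/-- The canonical map `V → A⁰`. -/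
noncomputable def quadGen (rel : Submodule k (TensorAlgebra k V)) : V →ₗ[k] QuadAlg rel :=
  (RingQuot.mkAlgHom k (quadRel rel)).toLinearMap ∘ₗ TensorAlgebra.ι k

/-- For an algebra generated by `V`, the image of `V ⊗ ⋯ ⊗ V` (`m` factors). -/
def genDeg (gen : V →ₗ[k] A) (m : ℕ) : Submodule k A := LinearMap.range gen ^ m

/-- The associated graded algebra `gr A` for the filtration by total degree in the generators. -/
abbrev AssocGr (gen : V →ₗ[k] A) := GenFilt.Gr (LinearMap.range gen)

/-- The grading of `gr A`. -/
noncomputable abbrev assocGrading (gen : V →ₗ[k] A) : ℕ → Submodule k (AssocGr gen) :=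
  GenFilt.grading (LinearMap.range gen)

/-- The canonical map `V → gr A`. -/
noncomputable def assocGen (gen : V →ₗ[k] A) (v : V) : AssocGr gen :=
  GenFilt.grOf (LinearMap.range gen) ⟨gen v, LinearMap.mem_range_self gen v⟩

/-- An almost quadratic algebra is PBW if for some bases `b` of `V` and `r` of the space of
relations, `r` is a Groebner basis of the ideal of relations. -/
def IsPBW (gen : V →ₗ[k] A) (rel : Submodule k (TensorAlgebra k V)) : Prop :=
  IsAlmostQuadratic gen rel ∧
    ∃ (n m : ℕ) (b : Module.Basis (Fin n) k V) (r : Module.Basis (Fin m) k rel),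
      IsGroebnerBasis b (Set.range fun i => (r i : TensorAlgebra k V))
        (TwoSidedIdeal.ker (TensorAlgebra.lift k gen))

/-- An almost quadratic algebra is (nonhomogeneous) Koszul if `A⁰` and `gr A` are isomorphic and
Koszul. -/
def IsKoszulAlmostQuadratic (gen : V →ₗ[k] A) (rel : Submodule k (TensorAlgebra k V)) : Prop :=
  IsAlmostQuadratic gen rel ∧
    GradedIso (genDeg (quadGen rel)) (assocGrading gen) (quadGen rel) (assocGen gen) ∧
    IsHomogeneousKoszul (genDeg (quadGen rel)) ∧
    IsHomogeneousKoszul (assocGrading gen)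

end AlmostQuadratic

/-!
Choose a homogeneous basis of `g`. The defining relations rewrite each word `v_i v_j` that is the
leading word of one of them into smaller words, and every ambiguity of this rewriting comes from a
word `v_i v_j v_l` with both factors of length two reducible. The color Jacobi identity resolves it;
when letters are repeated, the coefficients that appear have to be cancelled, which is where `2` and
`3` must be invertible. By Bergman's diamond lemma the words without reducible factors form a basis
of `U(g)`, and the relations form a Gröbner basis.

For the abelian color Lie algebra the rewriting is homogeneous, and Anick's resolution, whose `m`-th
term is free on the words of length `m` all of whose neighbouring pairs are reducible, is linear.
Finally `gr U(g)` and `U(g_ab)` have bases indexed by the same normal words, so the canonical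
homomorphism between them is an isomorphism.
-/

/-! ### Words and monomials -/

section Words

variable {X : Type*}

/-- The degree-lexicographical order on words for which `DegLexLT` is the case of the alphabet
`Fin n`: a letter that comes first in `X` counts as large. -/
abbrev WordLT [LinearOrder X] (u w : List X) : Prop := List.Shortlex (fun i j : X => j < i) u w

/-- The restriction of the degree-lexicographical order to pairs of words of equal length. It
controls rewriting by homogeneous relations. -/
def LexLT [LinearOrder X] (u w : List X) : Prop := u.length = w.length ∧ WordLT u w

/-- A well-founded order on words, not necessarily total, that is compatible with concatenation. -/
structure IsReductionOrder (R : List X → List X → Prop) : Prop where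
  wf : WellFounded R
  trans : ∀ {u v w}, R u v → R v w → R u w
  append : ∀ {u w}, R u w → ∀ p q, R (p ++ u ++ q) (p ++ w ++ q)

section Order

variable [LinearOrder X]

theorem WordLT.trans {u v w : List X} (huv : WordLT u v) (hvw : WordLT v w) : WordLT u w := by
  rw [WordLT, List.shortlex_def] at *
  rcases huv with huv | ⟨huv, lex_uv⟩ <;> rcases hvw with hvw | ⟨hvw, lex_vw⟩
  · left; omega
  · left; omega
  · left; omega
  · exact .inr ⟨huv.trans hvw, List.lex_trans (fun h h' => h'.trans h) lex_uv lex_vw⟩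

theorem WordLT.irrefl (u : List X) : ¬ WordLT u u := fun h =>
  Std.Asymm.asymm (r := WordLT (X := X)) u u h h

theorem WordLT.total (u w : List X) : WordLT u w ∨ u = w ∨ WordLT w u := by
  by_contra! h
  exact h.2.1 (Std.Trichotomous.trichotomous (r := WordLT (X := X)) u w h.1 h.2.2)

theorem WordLT.length_le {u w : List X} (h : WordLT u w) : u.length ≤ w.length := by
  rw [WordLT, List.shortlex_def] at h
  omega

theorem WordLT.append {u w : List X} (h : WordLT u w) (p q : List X) :
    WordLT (p ++ u ++ q) (p ++ w ++ q) := by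
  rw [List.append_assoc, List.append_assoc]
  refine List.Shortlex.append_left ?_ p
  rcases List.shortlex_def.1 h with hlen | ⟨hlen, hlex⟩
  · exact List.Shortlex.of_length_lt (by simpa using hlen)
  · refine List.Shortlex.of_lex (by simpa using hlen) ?_
    clear h
    induction hlex with
    | nil => simp at hlen
    | cons _ ih => exact List.Lex.cons (ih (by simpa using hlen))
    | rel hlt => exact List.Lex.rel hlt

theorem LexLT.wordLT {u w : List X} (h : LexLT u w) : WordLT u w := h.2

theorem LexLT.append {u w : List X} (h : LexLT u w) (p q : List X) :
    LexLT (p ++ u ++ q) (p ++ w ++ q) := ⟨by simp [h.1], h.2.append p q⟩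

theorem LexLT.of_lt {i j : X} (h : i < j) {p u w : List X} (hlen : u.length = w.length) :
    LexLT (p ++ j :: u) (p ++ i :: w) :=
  have lt : WordLT (j :: u) (i :: w) := .of_lex (by simp [hlen]) (.rel h)
  ⟨by simp [hlen], lt.append_left p⟩

theorem isReductionOrder_wordLT [WellFoundedGT X] : IsReductionOrder (WordLT (X := X)) where
  wf := List.Shortlex.wf wellFounded_gt
  trans := WordLT.trans
  append := WordLT.append

theorem isReductionOrder_lexLT [WellFoundedGT X] : IsReductionOrder (LexLT (X := X)) where
  wf := Subrelation.wf LexLT.wordLT isReductionOrder_wordLT.wf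
  trans huv hvw := ⟨huv.1.trans hvw.1, huv.2.trans hvw.2⟩
  append := LexLT.append

theorem exists_max_word {ι : Type*} {f : ι → List X} (hf : Function.Injective f) {s : Finset ι}
    (hs : s.Nonempty) : ∃ p ∈ s, ∀ q ∈ s, q ≠ p → WordLT (f q) (f p) := by
  induction hs using Finset.Nonempty.cons_induction with
  | singleton a => exact ⟨a, by simp, by simp⟩
  | cons a s ha _ ih =>
    obtain ⟨p, hp, hmax⟩ := ih
    rcases WordLT.total (f a) (f p) with h | h | h
    · refine ⟨p, Finset.mem_cons_of_mem hp, fun q hq hqp => ?_⟩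
      rcases Finset.mem_cons.1 hq with rfl | hq
      exacts [h, hmax q hq hqp]
    · exact absurd (hf h ▸ hp) ha
    · refine ⟨a, Finset.mem_cons_self a s, fun q hq hqa => ?_⟩
      have hq : q ∈ s := (Finset.mem_cons.1 hq).resolve_left hqa
      by_cases hqp : q = p
      exacts [hqp ▸ h, (hmax q hq hqp).trans h]

end Order

/-- The monomial in the elements `x i` attached to a word. -/
def mon {A : Type*} [Monoid A] (x : X → A) (w : List X) : A := (w.map x).prod

section Mon

variable {A : Type*} [Monoid A] (x : X → A)

@[simp] theorem mon_nil : mon x [] = 1 := rfl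

@[simp] theorem mon_cons (i : X) (w : List X) : mon x (i :: w) = x i * mon x w := by
  simp [mon]

@[simp] theorem mon_append (u w : List X) : mon x (u ++ w) = mon x u * mon x w := by
  simp [mon]

theorem map_mon {B F : Type*} [Monoid B] [FunLike F A B] [MonoidHomClass F A B] (f : F)
    (w : List X) : f (mon x w) = mon (f ∘ x) w := by
  simp [mon, map_list_prod]

end Mon

/-- A word is normal if no two neighbouring letters are in the relation `D`. -/
def NormalWord (D : X → X → Prop) (w : List X) : Prop := w.IsChain fun i j => ¬ D i j

section NormalWord

variable {D : X → X → Prop}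

theorem normalWord_nil : NormalWord D [] := List.isChain_nil

theorem normalWord_singleton (i : X) : NormalWord D [i] := List.isChain_singleton _

theorem not_normalWord_iff {w : List X} :
    ¬ NormalWord D w ↔ ∃ p i j q, w = p ++ i :: j :: q ∧ D i j := by
  simp only [NormalWord, List.isChain_iff_forall_rel_of_append_cons_cons, not_forall, not_not]
  constructor
  · rintro ⟨i, j, p, q, hw, h⟩
    exact ⟨p, i, j, q, hw, h⟩
  · rintro ⟨p, i, j, q, hw, h⟩
    exact ⟨i, j, p, q, hw, h⟩

end NormalWord

end Words

section Monomials

variable {k A X : Type*} [Field k] [Ring A] [Algebra k A] (x : X → A)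

theorem span_range_pow (m : ℕ) :
    Submodule.span k (Set.range x) ^ m = Submodule.span k (mon x '' {w | w.length = m}) := by
  induction m with
  | zero =>
    rw [pow_zero, Submodule.one_eq_span]
    congr 1
    ext y
    simp [List.length_eq_zero_iff]
  | succ m ih =>
    rw [pow_succ', ih, Submodule.span_mul_span]
    congr 1
    ext y
    simp only [Set.mem_mul, Set.mem_range, Set.mem_image, Set.mem_ofPred_eq]
    constructor
    · rintro ⟨_, ⟨i, rfl⟩, _, ⟨w, hw, rfl⟩, rfl⟩
      exact ⟨i :: w, by simp [hw], by simp⟩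
    · rintro ⟨w, hw, rfl⟩
      obtain ⟨i, w, rfl⟩ := List.exists_cons_of_length_eq_add_one hw
      exact ⟨_, ⟨i, rfl⟩, _, ⟨w, by simpa using hw, rfl⟩, by simp⟩

variable {x}

theorem mon_mul_mem_span {S S' : Set (List X)} {a : A} {p q : List X}
    (ha : a ∈ Submodule.span k (mon x '' S)) (hS : ∀ u ∈ S, p ++ u ++ q ∈ S') :
    mon x p * a * mon x q ∈ Submodule.span k (mon x '' S') := by
  refine Submodule.span_induction (p := fun a _ => mon x p * a * mon x q ∈ _)
    ?_ (by simp) (fun a b _ _ ha hb => ?_) (fun c a _ ha => ?_) ha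
  · rintro _ ⟨u, hu, rfl⟩
    exact Submodule.subset_span ⟨p ++ u ++ q, hS u hu, by simp only [mon_append]⟩
  · rw [mul_add, add_mul]
    exact add_mem ha hb
  · rw [mul_smul_comm, smul_mul_assoc]
    exact Submodule.smul_mem _ c ha

theorem linearIndependent_mon_comp {B : Type*} [Ring B] [Algebra k B] {D : X → X → Prop}
    {f : A →ₐ[k] B} (hx : LinearIndependent k (mon x))
    (hf : Disjoint (Submodule.span k (Set.range fun w : {w // NormalWord D w} => mon x w.1))
      (LinearMap.ker f.toLinearMap)) :
    LinearIndependent k fun w : {w // NormalWord D w} => mon (f ∘ x) w.1 := by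
  simpa only [Function.comp_def, AlgHom.toLinearMap_apply, map_mon] using
    (hx.comp (Subtype.val : {w // NormalWord D w} → List X) Subtype.val_injective).map hf

theorem mon_mem_span_normalWord {D : X → X → Prop} {R : List X → List X → Prop}
    (hR : IsReductionOrder R)
    (rewrite : ∀ i j, D i j → mon x [i, j] ∈ Submodule.span k (mon x '' {u | R u [i, j]}))
    (w : List X) :
    mon x w ∈ Submodule.span k (mon x '' {v | NormalWord D v ∧ (v = w ∨ R v w)}) := by
  induction w using hR.wf.induction with
  | _ w ih =>
  by_cases hw : NormalWord D w
  · exact Submodule.subset_span ⟨w, ⟨hw, .inl rfl⟩, rfl⟩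
  obtain ⟨p, i, j, q, rfl, hD⟩ := not_normalWord_iff.1 hw
  have smaller : mon x (p ++ i :: j :: q) ∈
      Submodule.span k (mon x '' {u | R u (p ++ i :: j :: q)}) := by
    simpa [mul_assoc] using mon_mul_mem_span (rewrite i j hD) (p := p) (q := q)
      (S' := {u | R u (p ++ i :: j :: q)}) fun u hu => by simpa using hR.append hu p q
  refine Submodule.span_le.2 ?_ smaller
  rintro _ ⟨u, hu, rfl⟩
  refine Submodule.span_mono (Set.image_mono ?_) (ih u hu)
  rintro v ⟨hv, rfl | hvu⟩
  exacts [⟨hv, .inr hu⟩, ⟨hv, .inr (hR.trans hvu hu)⟩]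

end Monomials

section LeadingWords

variable {k A X : Type*} [Field k] [Ring A] [Algebra k A] [LinearOrder X]

/-- `f` is a nonzero multiple of the monomial of `w` plus a linear combination of smaller
monomials. -/
def HasLeadingWord (k : Type*) {A : Type*} [Field k] [Ring A] [Algebra k A] (x : X → A) (f : A)
    (w : List X) : Prop :=
  ∃ c : k, c ≠ 0 ∧ f - c • mon x w ∈ Submodule.span k (mon x '' {u | WordLT u w})

variable {x : X → A} {f : A} {u w : List X}

theorem hasLeadingWord_mon (x : X → A) (w : List X) : HasLeadingWord k x (mon x w) w :=
  ⟨1, one_ne_zero, by simp⟩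

theorem HasLeadingWord.smul (h : HasLeadingWord k x f w) {a : k} (ha : a ≠ 0) :
    HasLeadingWord k x (a • f) w := by
  obtain ⟨c, hc, hf⟩ := h
  refine ⟨a * c, mul_ne_zero ha hc, ?_⟩
  rw [mul_smul, ← smul_sub]
  exact Submodule.smul_mem _ a hf

theorem HasLeadingWord.mem_span (h : HasLeadingWord k x f w) :
    f ∈ Submodule.span k (mon x '' {u | u = w ∨ WordLT u w}) := by
  obtain ⟨c, -, hf⟩ := h
  rw [← sub_add_cancel f (c • mon x w)]
  exact add_mem (Submodule.span_mono (Set.image_mono fun u hu => .inr hu) hf)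
    (Submodule.smul_mem _ c (Submodule.subset_span ⟨w, .inl rfl, rfl⟩))

theorem HasLeadingWord.mem_span_of_lt (h : HasLeadingWord k x f u) (huw : WordLT u w) :
    f ∈ Submodule.span k (mon x '' {u | WordLT u w}) := by
  refine Submodule.span_mono (Set.image_mono ?_) h.mem_span
  rintro v (rfl | hvu)
  exacts [huw, hvu.trans huw]

theorem HasLeadingWord.notMem_span (hx : LinearIndependent k (mon x))
    (h : HasLeadingWord k x f w) : f ∉ Submodule.span k (mon x '' {u | WordLT u w}) := by
  obtain ⟨c, hc, hf⟩ := h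
  intro hf'
  refine hx.notMem_span_image (s := {u | WordLT u w}) (WordLT.irrefl w) ?_
  rw [← Submodule.smul_mem_iff _ hc, ← sub_sub_cancel f (c • mon x w)]
  exact sub_mem hf' hf

theorem HasLeadingWord.ne_zero (hx : LinearIndependent k (mon x)) (h : HasLeadingWord k x f w) :
    f ≠ 0 := fun h0 => h.notMem_span hx (h0 ▸ zero_mem _)

theorem HasLeadingWord.unique (hx : LinearIndependent k (mon x)) (hu : HasLeadingWord k x f u)
    (hw : HasLeadingWord k x f w) : u = w := by
  rcases WordLT.total u w with h | h | h
  exacts [absurd (hu.mem_span_of_lt h) (hw.notMem_span hx), h,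
    absurd (hw.mem_span_of_lt h) (hu.notMem_span hx)]

variable {ι : Type*} {F : ι → A} {W : ι → List X}

theorem hasLeadingWord_linearCombination (hW : Function.Injective W)
    (hF : ∀ i, HasLeadingWord k x (F i) (W i)) {c : ι →₀ k} (hc : c ≠ 0) :
    ∃ i, HasLeadingWord k x (Finsupp.linearCombination k F c) (W i) := by
  classical
  obtain ⟨i, hi, hmax⟩ := exists_max_word hW (Finsupp.support_nonempty_iff.2 hc)
  refine ⟨i, ?_⟩
  obtain ⟨a, ha, hFi⟩ := (hF i).smul (Finsupp.mem_support_iff.1 hi)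
  refine ⟨a, ha, ?_⟩
  rw [Finsupp.linearCombination_apply, Finsupp.sum, ← Finset.add_sum_erase _ _ hi,
    add_sub_right_comm]
  refine add_mem hFi (sum_mem fun j hj => ?_)
  obtain ⟨hji, hj⟩ := Finset.mem_erase.1 hj
  exact Submodule.smul_mem _ _ ((hF j).mem_span_of_lt (hmax j hj hji))

theorem linearIndependent_of_hasLeadingWord (hx : LinearIndependent k (mon x))
    (hW : Function.Injective W) (hF : ∀ i, HasLeadingWord k x (F i) (W i)) :
    LinearIndependent k F := by
  refine linearIndependent_iff.2 fun c hc => ?_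
  by_contra hc0
  obtain ⟨i, hi⟩ := hasLeadingWord_linearCombination hW hF hc0
  exact hi.ne_zero hx hc

end LeadingWords

/-! ### The Anick resolution of an algebra with quadratic straightening laws -/

/-- The words of length `m` all of whose neighbouring letters are in the relation `D`. They index
the generators of the `m`-th term of the Anick resolution. -/
def WordChain {X : Type*} (D : X → X → Prop) (m : ℕ) : Type _ :=
  {c : List X // c.length = m ∧ c.IsChain D}

namespace WordChain

variable {X : Type*} {D : X → X → Prop} {m : ℕ}

noncomputable instance : DecidableEq (WordChain D m) := Classical.decEq _

instance [Finite X] : Finite (WordChain D m) :=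
  Set.Finite.to_subtype ((List.finite_length_eq X m).subset fun _ h => h.1)

noncomputable instance [Finite X] : Fintype (WordChain D m) := Fintype.ofFinite _

instance : Unique (WordChain D 0) where
  default := ⟨[], rfl, List.isChain_nil⟩
  uniq c := Subtype.ext (List.length_eq_zero_iff.1 c.2.1)

theorem ne_nil (c : WordChain D (m + 1)) : c.1 ≠ [] := by
  rw [← List.length_pos_iff, c.2.1]
  exact m.succ_pos

/-- A chain without its last letter. -/
def front (c : WordChain D (m + 1)) : WordChain D m :=
  ⟨c.1.dropLast, by simp [c.2.1], c.2.2.dropLast⟩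

/-- The last letter of a chain. -/
def last (c : WordChain D (m + 1)) : X := c.1.getLast c.ne_nil

theorem front_append_last (c : WordChain D (m + 1)) : c.front.1 ++ [c.last] = c.1 :=
  List.dropLast_append_getLast c.ne_nil

theorem front_append_last_cons (c : WordChain D (m + 1)) (w : List X) :
    c.front.1 ++ c.last :: w = c.1 ++ w := by
  rw [← List.singleton_append, ← List.append_assoc, front_append_last]

/-- The extension of a chain by a letter. -/
def snoc (c : WordChain D m) (i : X) (h : (c.1 ++ [i]).IsChain D) : WordChain D (m + 1) :=
  ⟨c.1 ++ [i], by simp [c.2.1], h⟩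

@[simp] theorem front_snoc (c : WordChain D m) (i : X) (h : (c.1 ++ [i]).IsChain D) :
    (c.snoc i h).front = c := Subtype.ext (by simp [front, snoc])

@[simp] theorem last_snoc (c : WordChain D m) (i : X) (h : (c.1 ++ [i]).IsChain D) :
    (c.snoc i h).last = i := by simp [last, snoc]

theorem isChain_append_singleton (c : WordChain D (m + 1)) (i : X) :
    (c.1 ++ [i]).IsChain D ↔ D c.last i := by
  rw [← c.front_append_last_cons [i], List.isChain_append_cons_cons, front_append_last]
  simp [c.2.2]

theorem rel_last_last (c : WordChain D (m + 2)) : D c.front.last c.last :=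
  (c.front.isChain_append_singleton c.last).1 (c.front_append_last.symm ▸ c.2.2)

end WordChain

/-- `S` contains, with each word, all smaller words of the same length. -/
def LowerClosed {X : Type*} [LinearOrder X] (S : Set (List X)) : Prop :=
  ∀ u ∈ S, ∀ v, LexLT v u → v ∈ S

theorem lowerClosed_univ {X : Type*} [LinearOrder X] : LowerClosed (Set.univ : Set (List X)) :=
  fun _ _ _ _ => trivial

theorem lowerClosed_lexLT {X : Type*} [LinearOrder X] (w : List X) : LowerClosed {u | LexLT u w} :=
  fun _ hu _ hv => ⟨hv.1.trans hu.1, hv.2.trans hu.2⟩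

theorem lowerClosed_wordLT {X : Type*} [LinearOrder X] (w : List X) :
    LowerClosed {u | WordLT u w} :=
  fun _ hu _ hv => hv.2.trans hu

/-- The normal words form a basis of `A`, and rewriting a monomial in this basis only involves
words of the same length that are not larger. -/
structure QuadraticStraightening (k : Type*) {A X : Type*} [Field k] [Ring A] [Algebra k A]
    [LinearOrder X] (x : X → A) (D : X → X → Prop) : Prop where
  linearIndependent : LinearIndependent k fun w : {w // NormalWord D w} => mon x w.1
  span_eq_top : Submodule.span k (Set.range (mon x)) = ⊤
  straighten : ∀ w, mon x w ∈
    Submodule.span k (mon x '' {v | NormalWord D v ∧ (v = w ∨ LexLT v w)})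

namespace QuadraticStraightening

variable {X : Type*} {D : X → X → Prop}

/-- The index set of the `k`-basis of the free module on the chains of length `m`. -/
abbrev ChainIndex (D : X → X → Prop) (m : ℕ) := Σ _ : WordChain D m, {w // NormalWord D w}

/-- The word attached to a basis element of the free module on chains; these words order the
basis. -/
def chainWord {m : ℕ} (p : ChainIndex D m) : List X := p.1.1 ++ p.2.1

theorem chainWord_injective {m : ℕ} : Function.Injective (chainWord (D := D) (m := m)) := by
  rintro ⟨c, v⟩ ⟨c', v'⟩ hp
  obtain ⟨h1, h2⟩ := List.append_inj hp (c.2.1.trans c'.2.1.symm)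
  obtain rfl := Subtype.ext h1
  obtain rfl := Subtype.ext h2
  rfl

section ChainMap

variable {A : Type*} [Ring A] [Finite X] {m : ℕ}

/-- The right linear map of free modules on chains with given values on the generators. -/
noncomputable def chainMap (φ : WordChain D (m + 1) → WordChain D m → A) :
    (WordChain D (m + 1) → A) →ₗ[Aᵐᵒᵖ] (WordChain D m → A) where
  toFun f := ∑ c, MulOpposite.op (f c) • φ c
  map_add' f f' := by simp [add_smul, Finset.sum_add_distrib]
  map_smul' a f := by simp [Finset.smul_sum, mul_smul]

theorem chainMap_apply (φ : WordChain D (m + 1) → WordChain D m → A) (f : WordChain D (m + 1) → A) :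
    chainMap φ f = ∑ c, MulOpposite.op (f c) • φ c := rfl

theorem chainMap_single (φ : WordChain D (m + 1) → WordChain D m → A) (c : WordChain D (m + 1))
    (a : A) : chainMap φ (Pi.single c a) = MulOpposite.op a • φ c := by
  rw [chainMap_apply, Finset.sum_eq_single c]
  · simp
  · intro b _ hb
    simp [hb]
  · simp

end ChainMap

variable {k A : Type*} [Field k] [Ring A] [Algebra k A] [LinearOrder X] {x : X → A}

section WordSpan

variable (h : QuadraticStraightening k x D)
include h

theorem span_normalWord : ⊤ ≤
    Submodule.span k (Set.range fun w : {w // NormalWord D w} => mon x w.1) := by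
  rw [← h.span_eq_top, Submodule.span_le]
  rintro _ ⟨w, rfl⟩
  refine Submodule.span_mono ?_ (h.straighten w)
  rintro _ ⟨v, hv, rfl⟩
  exact ⟨⟨v, hv.1⟩, rfl⟩

/-- The basis of normal words. -/
noncomputable def basis : Module.Basis {w // NormalWord D w} k A :=
  Module.Basis.mk h.linearIndependent h.span_normalWord

@[simp] theorem basis_apply (w : {w // NormalWord D w}) : h.basis w = mon x w.1 := by
  simp [basis]

variable [Finite X]

/-- The basis of the free module on chains, formed by pairs of a chain and a normal word. -/
noncomputable def chainBasis (m : ℕ) : Module.Basis (ChainIndex D m) k (WordChain D m → A) :=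
  Pi.basis fun _ => h.basis

theorem chainBasis_apply {m : ℕ} (p : ChainIndex D m) :
    h.chainBasis m p = Pi.single p.1 (mon x p.2.1) := by
  rw [chainBasis, Pi.basis_apply, basis_apply]

/-- The elements of the free module on chains whose words belong to `S`. -/
noncomputable def wordSpan (m : ℕ) (S : Set (List X)) : Submodule k (WordChain D m → A) :=
  Submodule.span k (h.chainBasis m '' {p | chainWord p ∈ S})

theorem mem_wordSpan {m : ℕ} {S : Set (List X)} {z : WordChain D m → A} :
    z ∈ h.wordSpan m S ↔ ∀ p, (h.chainBasis m).repr z p ≠ 0 → chainWord p ∈ S := by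
  rw [wordSpan, Module.Basis.mem_span_image]
  simp [Set.subset_def]

theorem wordSpan_mono {m : ℕ} {S S' : Set (List X)} (hS : S ⊆ S') :
    h.wordSpan m S ≤ h.wordSpan m S' :=
  Submodule.span_mono (Set.image_mono fun _ hp => hS hp)

theorem mem_wordSpan_univ {m : ℕ} (z : WordChain D m → A) : z ∈ h.wordSpan m Set.univ :=
  h.mem_wordSpan.2 fun _ _ => trivial

theorem single_mem_wordSpan {m : ℕ} {S T : Set (List X)} {c : WordChain D m} {a : A}
    (ha : a ∈ Submodule.span k (mon x '' T)) (hT : ∀ v ∈ T, NormalWord D v ∧ c.1 ++ v ∈ S) :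
    Pi.single c a ∈ h.wordSpan m S := by
  have hmap := Submodule.mem_map_of_mem (f := LinearMap.single k (fun _ : WordChain D m => A) c) ha
  rw [Submodule.map_span] at hmap
  refine Submodule.span_le.2 ?_ hmap
  rintro _ ⟨_, ⟨v, hv, rfl⟩, rfl⟩
  exact Submodule.subset_span
    ⟨⟨c, ⟨v, (hT v hv).1⟩⟩, (hT v hv).2, by simp [chainBasis_apply]⟩

theorem single_mon_mem {m : ℕ} {S : Set (List X)} (hS : LowerClosed S) {c : WordChain D m}
    {w : List X} (hw : c.1 ++ w ∈ S) : Pi.single c (mon x w) ∈ h.wordSpan m S := by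
  refine h.single_mem_wordSpan (h.straighten w) ?_
  rintro v ⟨hn, rfl | hv⟩
  · exact ⟨hn, hw⟩
  · exact ⟨hn, hS _ hw _ (by simpa using hv.append c.1 [])⟩

theorem single_mon_mem_lower {m : ℕ} (c : WordChain D m) {w : List X} (hw : ¬ NormalWord D w) :
    Pi.single c (mon x w) ∈ h.wordSpan m {u | LexLT u (c.1 ++ w)} := by
  refine h.single_mem_wordSpan (h.straighten w) ?_
  rintro v ⟨hn, rfl | hv⟩
  · exact absurd hn hw
  · exact ⟨hn, by simpa using hv.append c.1 []⟩

theorem wordSpan_mul_mon {m : ℕ} {S S' : Set (List X)} (hS' : LowerClosed S') {w : List X}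
    (hw : ∀ u ∈ S, u ++ w ∈ S') {z : WordChain D m → A} (hz : z ∈ h.wordSpan m S) :
    MulOpposite.op (mon x w) • z ∈ h.wordSpan m S' := by
  refine Submodule.span_induction
    (p := fun z _ => MulOpposite.op (mon x w) • z ∈ h.wordSpan m S') ?_ (by simp) ?_ ?_ hz
  · rintro _ ⟨p, hp, rfl⟩
    rw [chainBasis_apply, ← Pi.single_smul, op_smul_eq_mul, ← mon_append]
    exact h.single_mon_mem hS' (by simpa [chainWord] using hw _ hp)
  · intro z z' _ _ hz hz'
    rw [smul_add]
    exact add_mem hz hz'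
  · intro a z _ hz
    rw [smul_comm]
    exact Submodule.smul_mem _ a hz

end WordSpan

variable [Finite X] {m : ℕ} {φ : WordChain D (m + 1) → WordChain D m → A}

/-- The value on each generator is the last letter of the chain, up to smaller words. -/
def IsTriangular (h : QuadraticStraightening k x D)
    (φ : WordChain D (m + 1) → WordChain D m → A) : Prop :=
  ∀ c, φ c - Pi.single c.front (x c.last) ∈ h.wordSpan m {u | LexLT u c.1}

/-- `p` is the leading basis element of `z`. -/
def IsLeading (h : QuadraticStraightening k x D) (z : WordChain D m → A) (p : ChainIndex D m) :
    Prop :=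
  (h.chainBasis m).repr z p ≠ 0 ∧
    ∀ q, (h.chainBasis m).repr z q ≠ 0 → q ≠ p → WordLT (chainWord q) (chainWord p)

/-- The map given by `φ` is strict for the filtrations of the free modules by sets of words. -/
def IsStrict (h : QuadraticStraightening k x D) (φ : WordChain D (m + 1) → WordChain D m → A) :
    Prop :=
  ∀ S, LowerClosed S → ∀ f, chainMap φ f ∈ h.wordSpan m S →
    ∃ f' ∈ h.wordSpan (m + 1) S, chainMap φ f' = chainMap φ f

variable {h : QuadraticStraightening k x D}

section Leading

variable {z : WordChain D m → A} {p : ChainIndex D m}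

theorem exists_isLeading (h : QuadraticStraightening k x D) (hz : z ≠ 0) :
    ∃ p, h.IsLeading z p := by
  obtain ⟨p, hp, hmax⟩ := exists_max_word chainWord_injective
    (s := ((h.chainBasis m).repr z).support) (by simpa using hz)
  exact ⟨p, by simpa using hp, fun q hq => hmax q (by simpa using hq)⟩

theorem IsLeading.sub_mem (hp : h.IsLeading z p) {S : Set (List X)} (hz : z ∈ h.wordSpan m S) :
    z - (h.chainBasis m).repr z p • h.chainBasis m p ∈
      h.wordSpan m {v | v ∈ S ∧ WordLT v (chainWord p)} := by
  refine h.mem_wordSpan.2 fun q hq => ?_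
  by_cases hqp : q = p
  · simp [hqp] at hq
  · have hzq : (h.chainBasis m).repr z q ≠ 0 := by
      simpa [Finsupp.single_apply, Ne.symm hqp] using hq
    exact ⟨h.mem_wordSpan.1 hz q hzq, hp.2 q hzq hqp⟩

end Leading

namespace IsTriangular

theorem chainMap_single_mon (hφ : h.IsTriangular φ) (c : WordChain D (m + 1)) (w : List X) :
    chainMap φ (Pi.single c (mon x w)) - Pi.single c.front (mon x (c.last :: w)) ∈
      h.wordSpan m {u | LexLT u (c.1 ++ w)} := by
  have hmul := h.wordSpan_mul_mon (lowerClosed_lexLT (c.1 ++ w))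
    (fun u hu => by simpa using LexLT.append hu [] w) (hφ c)
  rwa [smul_sub, ← Pi.single_smul, op_smul_eq_mul, ← mon_cons, ← chainMap_single] at hmul

theorem chainMap_mem (hφ : h.IsTriangular φ) {S : Set (List X)} (hS : LowerClosed S)
    {f : WordChain D (m + 1) → A} (hf : f ∈ h.wordSpan (m + 1) S) :
    chainMap φ f ∈ h.wordSpan m S := by
  refine Submodule.span_induction (p := fun z _ => chainMap φ z ∈ h.wordSpan m S) ?_ (by simp)
    ?_ ?_ hf
  · rintro _ ⟨p, hp, rfl⟩
    rw [chainBasis_apply,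
      ← sub_add_cancel (chainMap φ _) (Pi.single p.1.front (mon x (p.1.last :: p.2.1)))]
    refine add_mem (h.wordSpan_mono (hS _ hp) (hφ.chainMap_single_mon _ _))
      (h.single_mon_mem hS ?_)
    rwa [WordChain.front_append_last_cons]
  · intro z z' _ _ hz hz'
    rw [map_add]
    exact add_mem hz hz'
  · intro a z _ hz
    rw [LinearMap.map_smul_of_tower]
    exact Submodule.smul_mem _ a hz

theorem exists_sub_chainMap_mem (hφ : h.IsTriangular φ) {S : Set (List X)} (hS : LowerClosed S)
    {z : WordChain D m → A} (hz : z ∈ h.wordSpan m S) {p : ChainIndex D m} (hp : h.IsLeading z p)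
    {i : X} {w : List X} (hpw : p.2.1 = i :: w) (hc : (p.1.1 ++ [i]).IsChain D) :
    ∃ f ∈ h.wordSpan (m + 1) S,
      z - chainMap φ f ∈ h.wordSpan m {v | v ∈ S ∧ WordLT v (chainWord p)} := by
  obtain ⟨c, v, hv⟩ := p
  obtain rfl : v = i :: w := hpw
  set a := (h.chainBasis m).repr z ⟨c, ⟨i :: w, hv⟩⟩
  set q : ChainIndex D (m + 1) := ⟨c.snoc i hc, ⟨w, hv.tail⟩⟩
  have word_eq : c.1 ++ i :: w = (c.snoc i hc).1 ++ w := by simp [WordChain.snoc]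
  have word_mem : c.1 ++ i :: w ∈ S := h.mem_wordSpan.1 hz _ hp.1
  have q_mem : h.chainBasis (m + 1) q ∈ h.wordSpan (m + 1) S :=
    Submodule.subset_span ⟨q, by simpa [chainWord, q, ← word_eq] using word_mem, rfl⟩
  refine ⟨a • h.chainBasis (m + 1) q, Submodule.smul_mem _ a q_mem, ?_⟩
  have image_q : chainMap φ (h.chainBasis (m + 1) q) - h.chainBasis m ⟨c, ⟨i :: w, hv⟩⟩ ∈
      h.wordSpan m {v | v ∈ S ∧ WordLT v (c.1 ++ i :: w)} := by
    have := hφ.chainMap_single_mon (c.snoc i hc) w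
    rw [WordChain.front_snoc, WordChain.last_snoc, ← word_eq] at this
    rw [chainBasis_apply, chainBasis_apply]
    refine h.wordSpan_mono ?_ this
    exact fun v hv => ⟨hS _ word_mem v hv, hv.2⟩
  convert sub_mem (hp.sub_mem hz) (Submodule.smul_mem _ a image_q) using 1
  rw [LinearMap.map_smul_of_tower, smul_sub]
  abel

theorem exists_preimage (hφ : h.IsTriangular φ) (K : Submodule k (WordChain D m → A))
    (hK : ∀ f, chainMap φ f ∈ K)
    (hlead : ∀ z ∈ K, ∀ p, h.IsLeading z p → ∃ i w, p.2.1 = i :: w ∧ (p.1.1 ++ [i]).IsChain D)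
    {S : Set (List X)} (hS : LowerClosed S) {z : WordChain D m → A} (hzK : z ∈ K)
    (hz : z ∈ h.wordSpan m S) : ∃ f ∈ h.wordSpan (m + 1) S, chainMap φ f = z := by
  by_cases hz0 : z = 0
  · exact ⟨0, zero_mem _, by rw [map_zero, hz0]⟩
  obtain ⟨p, hp⟩ := exists_isLeading h hz0
  induction hw : chainWord p using (isReductionOrder_wordLT (X := X)).wf.induction
    generalizing z p with
  | _ w ih =>
  obtain ⟨i, u, hpu, hc⟩ := hlead z hzK p hp
  obtain ⟨f, hf, hzf⟩ := hφ.exists_sub_chainMap_mem hS hz hp hpu hc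
  by_cases hz' : z - chainMap φ f = 0
  · exact ⟨f, hf, (sub_eq_zero.1 hz').symm⟩
  obtain ⟨p', hp'⟩ := exists_isLeading h hz'
  obtain ⟨f', hf', hff'⟩ := ih (chainWord p') (hw ▸ (h.mem_wordSpan.1 hzf p' hp'.1).2)
    (sub_mem hzK (hK f)) (h.wordSpan_mono (fun v hv => hv.1) hzf) hz' p' hp' rfl
  exact ⟨f' + f, add_mem hf' hf, by rw [map_add, hff', sub_add_cancel]⟩

theorem chainMap_ne_zero (hφ : h.IsTriangular φ) {z : WordChain D (m + 1) → A}
    {p : ChainIndex D (m + 1)} (hp : h.IsLeading z p) (hn : NormalWord D (p.1.last :: p.2.1)) :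
    chainMap φ z ≠ 0 := by
  intro hz
  set a := (h.chainBasis (m + 1)).repr z p
  let q : ChainIndex D m := ⟨p.1.front, ⟨p.1.last :: p.2.1, hn⟩⟩
  have word_q : chainWord q = chainWord p := p.1.front_append_last_cons _
  have tail_mem : chainMap φ (z - a • h.chainBasis (m + 1) p) ∈
      h.wordSpan m {u | WordLT u (chainWord p)} :=
    hφ.chainMap_mem (lowerClosed_wordLT _)
      (h.wordSpan_mono (fun v hv => hv.2) (hp.sub_mem (h.mem_wordSpan_univ z)))
  have head_mem : chainMap φ (h.chainBasis (m + 1) p) - h.chainBasis m q ∈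
      h.wordSpan m {u | WordLT u (chainWord p)} := by
    rw [chainBasis_apply, chainBasis_apply]
    exact h.wordSpan_mono (fun v hv => hv.2) (hφ.chainMap_single_mon p.1 p.2.1)
  have q_mem : a • h.chainBasis m q ∈ h.wordSpan m {u | WordLT u (chainWord p)} := by
    convert neg_mem (add_mem tail_mem (Submodule.smul_mem _ a head_mem)) using 1
    rw [map_sub, hz, LinearMap.map_smul_of_tower, smul_sub]
    abel
  exact WordLT.irrefl _ (word_q ▸ h.mem_wordSpan.1 q_mem q (by simpa using hp.1))

theorem isLeading_of_ker (hφ : h.IsTriangular φ) {z : WordChain D (m + 1) → A}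
    (hz : chainMap φ z = 0) {p : ChainIndex D (m + 1)} (hp : h.IsLeading z p) :
    ∃ i w, p.2.1 = i :: w ∧ (p.1.1 ++ [i]).IsChain D := by
  by_contra! hcon
  refine hφ.chainMap_ne_zero hp ?_ hz
  obtain ⟨c, v, hv⟩ := p
  cases v with
  | nil => exact normalWord_singleton _
  | cons j v =>
    exact List.isChain_cons_cons.2
      ⟨fun hD => hcon j v rfl ((c.isChain_append_singleton j).2 hD), hv⟩

theorem chainMap_single_last_mem (hφ : h.IsTriangular φ) (c : WordChain D (m + 2)) :
    chainMap φ (Pi.single c.front (x c.last)) ∈ h.wordSpan m {u | LexLT u c.1} := by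
  have h1 := hφ.chainMap_single_mon c.front [c.last]
  have h2 := h.single_mon_mem_lower c.front.front (w := [c.front.last, c.last])
    (not_normalWord_iff.2 ⟨[], _, _, [], rfl, c.rel_last_last⟩)
  rw [WordChain.front_append_last_cons] at h2
  rw [WordChain.front_append_last] at h1 h2
  simpa using add_mem h1 h2

/-- The next map of the resolution sends a chain to its last letter, corrected by a smaller
element with the same image. -/
theorem exists_next (hφ : h.IsTriangular φ) (hstrict : h.IsStrict φ) :
    ∃ ψ : WordChain D (m + 2) → WordChain D (m + 1) → A, h.IsTriangular ψ ∧ h.IsStrict ψ ∧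
      Function.Exact (chainMap ψ) (chainMap φ) := by
  choose y y_mem y_image using fun c : WordChain D (m + 2) =>
    hstrict _ (lowerClosed_lexLT _) _ (hφ.chainMap_single_last_mem c)
  let ψ : WordChain D (m + 2) → WordChain D (m + 1) → A :=
    fun c => Pi.single c.front (x c.last) - y c
  have hψ : h.IsTriangular ψ := fun c => by simpa [ψ] using y_mem c
  have comp_eq_zero : ∀ f, chainMap φ (chainMap ψ f) = 0 := fun f => by
    rw [chainMap_apply ψ, map_sum]
    exact Finset.sum_eq_zero fun c _ => by
      rw [map_smul, map_sub, y_image, sub_self, smul_zero]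
  have lift : ∀ S, LowerClosed S → ∀ z, chainMap φ z = 0 → z ∈ h.wordSpan (m + 1) S →
      ∃ f ∈ h.wordSpan (m + 2) S, chainMap ψ f = z := fun S hS z hz hzS =>
    hψ.exists_preimage ((LinearMap.ker (chainMap φ)).restrictScalars k) comp_eq_zero
      (fun z hz p hp => hφ.isLeading_of_ker hz hp) hS hz hzS
  refine ⟨ψ, hψ, fun S hS f hf => lift S hS _ (comp_eq_zero f) hf, fun z => ⟨fun hz => ?_, ?_⟩⟩
  · obtain ⟨f, -, hf⟩ := lift Set.univ lowerClosed_univ z hz (h.mem_wordSpan_univ z)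
    exact ⟨f, hf⟩
  · rintro ⟨f, rfl⟩
    exact comp_eq_zero f

end IsTriangular

end QuadraticStraightening

namespace QuadraticStraightening

theorem mon_mem_augRightIdeal {k A X : Type*} [Field k] [Ring A] [Algebra k A] {x : X → A}
    {w : List X} (hw : w ≠ []) :
    mon x w ∈ augRightIdeal fun m => Submodule.span k (Set.range x) ^ m := by
  refine Submodule.subset_span ⟨w.length, List.length_pos_iff.2 hw, ?_⟩
  change _ ∈ Submodule.span k (Set.range x) ^ _
  rw [span_range_pow]
  exact Submodule.subset_span ⟨w, rfl, rfl⟩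

section Grading

variable {k A X : Type*} [Field k] [Ring A] [Algebra k A] [LinearOrder X] {x : X → A}
  {D : X → X → Prop} (h : QuadraticStraightening k x D)
include h

theorem span_mon_image {S : Set (List X)} (hS : LowerClosed S) :
    Submodule.span k (mon x '' S) = Submodule.span k (h.basis '' {w | w.1 ∈ S}) := by
  refine le_antisymm (Submodule.span_le.2 ?_) (Submodule.span_mono ?_)
  · rintro _ ⟨w, hw, rfl⟩
    refine Submodule.span_mono ?_ (h.straighten w)
    rintro _ ⟨v, ⟨hn, hv⟩, rfl⟩
    exact ⟨⟨v, hn⟩, hv.elim (fun hvw => hvw ▸ hw) (hS w hw v), h.basis_apply _⟩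
  · rintro _ ⟨w, hw, rfl⟩
    exact ⟨w.1, hw, (h.basis_apply w).symm⟩

theorem span_range_pow_eq (m : ℕ) :
    Submodule.span k (Set.range x) ^ m = Submodule.span k (h.basis '' {w | w.1.length = m}) := by
  rw [span_range_pow]
  exact h.span_mon_image fun u hu v hv => hv.1.trans hu

theorem iSupIndep_span_range_pow : iSupIndep fun m => Submodule.span k (Set.range x) ^ m := by
  refine iSupIndep_def.2 fun m => ?_
  simp only [h.span_range_pow_eq, ← Submodule.span_iUnion]
  simp only [← Set.image_iUnion]
  refine h.basis.linearIndependent.disjoint_span_image (Set.disjoint_left.2 fun w hw hw' => ?_)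
  obtain ⟨j, hjm, hj⟩ := Set.mem_iUnion₂.1 hw'
  exact hjm (hj.symm.trans hw)

theorem isStandard [Finite X] : IsStandard fun m => Submodule.span k (Set.range x) ^ m where
  indep := h.iSupIndep_span_range_pow
  iSup_eq_top := by
    rw [eq_top_iff, ← h.span_eq_top, Submodule.span_le]
    rintro _ ⟨w, rfl⟩
    refine Submodule.mem_iSup_of_mem w.length ?_
    rw [span_range_pow]
    exact Submodule.subset_span ⟨w, rfl, rfl⟩
  mul_mem ha hb := by
    rw [pow_add]
    exact Submodule.mul_mem_mul ha hb
  finite m := by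
    rw [span_range_pow]
    exact Module.Finite.span_of_finite k ((List.finite_length_eq X m).image _)
  nontrivial := ⟨1, 0, by simpa using h.linearIndependent.ne_zero ⟨[], normalWord_nil⟩⟩
  zero_eq := pow_zero _
  generated := by
    rw [pow_one, Algebra.adjoin_span, ← Algebra.toSubmodule_eq_top, eq_top_iff, ← h.span_eq_top,
      Submodule.span_le]
    rintro _ ⟨w, rfl⟩
    refine Subalgebra.list_prod_mem _ fun y hy => ?_
    obtain ⟨i, _, rfl⟩ := List.mem_map.1 hy
    exact Algebra.subset_adjoin (Set.mem_range_self i)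

theorem restrictScalars_augRightIdeal :
    (augRightIdeal fun m => Submodule.span k (Set.range x) ^ m).restrictScalars k =
      Submodule.span k (mon x '' {w | w ≠ []}) := by
  refine le_antisymm (fun a ha => ?_) (Submodule.span_le.2 ?_)
  · refine Submodule.span_induction (p := fun a _ => a ∈ Submodule.span k (mon x '' {w | w ≠ []}))
      ?_ (zero_mem _) (fun _ _ _ _ => add_mem) ?_ ha
    · rintro a ⟨m, hm, ha⟩
      change a ∈ Submodule.span k (Set.range x) ^ m at ha
      rw [span_range_pow] at ha
      refine Submodule.span_mono (Set.image_mono fun w hw => ?_) ha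
      exact List.length_pos_iff.1 (hw.symm ▸ hm)
    · intro b a _ ha
      have hb : b.unop ∈ Submodule.span k (Set.range (mon x)) := h.span_eq_top ▸ Submodule.mem_top
      have hab := Submodule.mul_mem_mul ha hb
      rw [Submodule.span_mul_span] at hab
      refine Submodule.span_mono ?_ hab
      rintro _ ⟨_, ⟨v, hv, rfl⟩, _, ⟨w, rfl⟩, rfl⟩
      exact ⟨v ++ w, List.append_ne_nil_of_left_ne_nil hv w, mon_append x v w⟩
  · rintro _ ⟨w, hw, rfl⟩
    exact mon_mem_augRightIdeal hw

end Grading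

section Resolution

variable {k A X : Type*} [Field k] [Ring A] [Algebra k A] [LinearOrder X] [Finite X] {x : X → A}
  {D : X → X → Prop}

/-- The first map of the Anick resolution. -/
noncomputable def firstMap (x : X → A) (D : X → X → Prop) : WordChain D 1 → WordChain D 0 → A :=
  fun c => Pi.single c.front (x c.last)

/-- The kernel of the augmentation of the free module on the empty chain. -/
noncomputable def augKernel (k : Type*) {A X : Type*} [Field k] [Ring A] [Algebra k A] (x : X → A)
    (D : X → X → Prop) : Submodule Aᵐᵒᵖ (WordChain D 0 → A) :=
  (augRightIdeal fun m => Submodule.span k (Set.range x) ^ m).comap (LinearMap.proj default)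

omit [LinearOrder X] in
theorem chainMap_firstMap_mem (f : WordChain D 1 → A) :
    chainMap (firstMap x D) f ∈ augKernel k x D := by
  refine sum_mem fun c _ => Submodule.smul_mem _ _ ?_
  simpa [augKernel, firstMap, Unique.eq_default c.front] using
    mon_mem_augRightIdeal (k := k) (x := x) (List.cons_ne_nil c.last [])

variable (h : QuadraticStraightening k x D)

theorem isTriangular_firstMap : h.IsTriangular (firstMap x D) := fun c => by simp [firstMap]

variable {h} in
theorem isLeading_of_augKernel {z : WordChain D 0 → A} (hz : z ∈ augKernel k x D)
    {p : ChainIndex D 0} (hp : h.IsLeading z p) :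
    ∃ i w, p.2.1 = i :: w ∧ (p.1.1 ++ [i]).IsChain D := by
  obtain ⟨c, v, hv⟩ := p
  obtain rfl := Unique.eq_default c
  have hz' : z default ∈ Submodule.span k (mon x '' {w | w ≠ []}) := by
    rw [← h.restrictScalars_augRightIdeal]
    exact hz
  rw [h.span_mon_image fun u hu v hv => by
    rintro rfl
    exact hu (List.length_eq_zero_iff.1 hv.1.symm), Module.Basis.mem_span_image] at hz'
  obtain ⟨i, w, rfl⟩ := List.exists_cons_of_ne_nil (l := v)
    (@hz' ⟨v, hv⟩ (by simpa [chainBasis] using hp.1))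
  exact ⟨i, w, rfl, List.isChain_singleton i⟩

theorem exists_preimage_firstMap {S : Set (List X)} (hS : LowerClosed S)
    {z : WordChain D 0 → A} (hzK : z ∈ augKernel k x D) (hz : z ∈ h.wordSpan 0 S) :
    ∃ f ∈ h.wordSpan 1 S, chainMap (firstMap x D) f = z :=
  h.isTriangular_firstMap.exists_preimage ((augKernel k x D).restrictScalars k)
    chainMap_firstMap_mem (fun _ hz _ hp => isLeading_of_augKernel hz hp) hS hzK hz

theorem isStrict_firstMap : h.IsStrict (firstMap x D) := fun _ hS f hf =>
  h.exists_preimage_firstMap hS (chainMap_firstMap_mem f) hf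

/-- The maps of the Anick resolution. -/
noncomputable def resolution :
    ∀ m, {φ : WordChain D (m + 1) → WordChain D m → A // h.IsTriangular φ ∧ h.IsStrict φ}
  | 0 => ⟨firstMap x D, h.isTriangular_firstMap, h.isStrict_firstMap⟩
  | m + 1 =>
    have next := (resolution m).2.1.exists_next (resolution m).2.2
    ⟨next.choose, next.choose_spec.1, next.choose_spec.2.1⟩

theorem resolution_exact (m : ℕ) :
    Function.Exact (chainMap (h.resolution (m + 1)).1) (chainMap (h.resolution m).1) :=
  ((h.resolution m).2.1.exists_next (h.resolution m).2.2).choose_spec.2.2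

include h in
theorem exact_firstMap :
    Function.Exact (chainMap (firstMap x D))
      ((augRightIdeal fun m => Submodule.span k (Set.range x) ^ m).mkQ ∘ₗ
        (LinearMap.proj default : (WordChain D 0 → A) →ₗ[Aᵐᵒᵖ] A)) := fun z => by
  rw [LinearMap.comp_apply, Submodule.mkQ_apply, Submodule.Quotient.mk_eq_zero]
  constructor
  · intro hz
    obtain ⟨f, -, hf⟩ :=
      h.exists_preimage_firstMap lowerClosed_univ hz (h.mem_wordSpan_univ z)
    exact ⟨f, hf⟩
  · rintro ⟨f, rfl⟩
    exact chainMap_firstMap_mem f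

theorem IsTriangular.apply_mem {h : QuadraticStraightening k x D} {m : ℕ}
    {φ : WordChain D (m + 1) → WordChain D m → A} (hφ : h.IsTriangular φ)
    (c : WordChain D (m + 1)) (p : WordChain D m) : φ c p ∈ Submodule.span k (Set.range x) := by
  have single_mem : ∀ (q : WordChain D m) (i : X),
      (Pi.single q (x i) : WordChain D m → A) p ∈ Submodule.span k (Set.range x) := fun q i => by
    rcases eq_or_ne p q with rfl | hpq
    · simpa using Submodule.subset_span (Set.mem_range_self i)
    · simp [hpq]
  have lower_mem : h.wordSpan m {u | LexLT u c.1} ≤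
      (Submodule.span k (Set.range x)).comap (LinearMap.proj p) := by
    refine Submodule.span_le.2 ?_
    rintro _ ⟨⟨q, v, hv⟩, hq, rfl⟩
    have length_v : v.length = 1 := by
      have := hq.1
      simp only [chainWord, List.length_append, q.2.1, c.2.1] at this
      omega
    obtain ⟨i, rfl⟩ := List.length_eq_one_iff.1 length_v
    simpa [chainBasis_apply] using single_mem q i
  have sub_mem : φ c p - (Pi.single c.front (x c.last) : WordChain D m → A) p ∈
      Submodule.span k (Set.range x) := lower_mem (hφ c)
  exact (Submodule.sub_mem_iff_left _ (single_mem c.front c.last)).1 sub_mem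

end Resolution

theorem isHomogeneousKoszul {k A : Type*} {X : Type} [Field k] [Ring A] [Algebra k A]
    [LinearOrder X] [Finite X] {x : X → A} {D : X → X → Prop} (h : QuadraticStraightening k x D) :
    IsHomogeneousKoszul fun m => Submodule.span k (Set.range x) ^ m := by
  refine ⟨h.isStandard, WordChain D, inferInstance, (Submodule.mkQ _) ∘ₗ (LinearMap.proj default),
    fun i => chainMap (h.resolution i).1, ?_, ?_, ?_, h.exact_firstMap, h.resolution_exact⟩
  · intro m f hf
    rw [zero_add]
    exact ⟨f default, hf _, rfl⟩
  · intro i m f hf p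
    change chainMap _ f p ∈ Submodule.span k (Set.range x) ^ (m + 1)
    rw [chainMap_apply, Finset.sum_apply, pow_succ']
    exact sum_mem fun c _ => Submodule.mul_mem_mul ((h.resolution i).2.1.apply_mem c p) (hf c)
  · exact (Submodule.mkQ_surjective _).comp fun a => ⟨fun _ => a, rfl⟩

end QuadraticStraightening

/-! ### The diamond lemma for quadratic leading words -/

section DiamondLemma

variable {k A X : Type*} [Field k] [Ring A] [Algebra k A]

/-- The linear span of the multiples `p r_ij q` of the relations `r i j`, for `i`, `j` with `D i j`,
such that the word `p ++ [i, j] ++ q` belongs to `S`. -/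
def relSpan (k : Type*) {A X : Type*} [Field k] [Ring A] [Algebra k A] (x : X → A)
    (D : X → X → Prop) (r : X → X → A) (S : Set (List X)) : Submodule k A :=
  Submodule.span k {a | ∃ p i j q, D i j ∧ p ++ i :: j :: q ∈ S ∧ mon x p * r i j * mon x q = a}

variable {x : X → A} {D : X → X → Prop} {r : X → X → A} {S S' : Set (List X)}

theorem mon_mul_rel_mul_mon_mem {p q : List X} {i j : X} (hD : D i j)
    (hS : p ++ i :: j :: q ∈ S) : mon x p * r i j * mon x q ∈ relSpan k x D r S :=
  Submodule.subset_span ⟨p, i, j, q, hD, hS, rfl⟩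

theorem rel_mul_gen_mem_relSpan {i j : X} (hD : D i j) (l : X) (hS : [i, j, l] ∈ S) :
    r i j * x l ∈ relSpan k x D r S := by
  simpa using mon_mul_rel_mul_mon_mem (k := k) (x := x) (r := r) (p := []) (q := [l]) hD hS

theorem gen_mul_rel_mem_relSpan (i : X) {j l : X} (hD : D j l) (hS : [i, j, l] ∈ S) :
    x i * r j l ∈ relSpan k x D r S := by
  simpa using mon_mul_rel_mul_mon_mem (k := k) (x := x) (r := r) (p := [i]) (q := []) hD hS

theorem mon_mul_mem_relSpan {a : A} (ha : a ∈ relSpan k x D r S) {p : List X}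
    (hS : ∀ u ∈ S, p ++ u ∈ S') : mon x p * a ∈ relSpan k x D r S' := by
  refine (Submodule.span_le (p := (relSpan k x D r S').comap (LinearMap.mulLeft k (mon x p)))).2
    ?_ ha
  rintro _ ⟨p', i, j, q, hD, hu, rfl⟩
  simpa [mul_assoc] using mon_mul_rel_mul_mon_mem (k := k) (x := x) (r := r) (p := p ++ p')
    (q := q) hD (by simpa using hS _ hu)

theorem mul_mon_mem_relSpan {a : A} (ha : a ∈ relSpan k x D r S) {q : List X}
    (hS : ∀ u ∈ S, u ++ q ∈ S') : a * mon x q ∈ relSpan k x D r S' := by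
  refine (Submodule.span_le (p := (relSpan k x D r S').comap (LinearMap.mulRight k (mon x q)))).2
    ?_ ha
  rintro _ ⟨p, i, j, q', hD, hu, rfl⟩
  simpa [mul_assoc] using mon_mul_rel_mul_mon_mem (k := k) (x := x) (r := r) (p := p)
    (q := q' ++ q) hD (by simpa using hS _ hu)

theorem rel_mul_mem_relSpan {i j : X} (hD : D i j) {a : A}
    (ha : a ∈ Submodule.span k (mon x '' S)) (hS : ∀ u ∈ S, i :: j :: u ∈ S') :
    r i j * a ∈ relSpan k x D r S' := by
  refine (Submodule.span_le (p := (relSpan k x D r S').comap (LinearMap.mulLeft k (r i j)))).2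
    ?_ ha
  rintro _ ⟨u, hu, rfl⟩
  simpa using mon_mul_rel_mul_mon_mem (k := k) (x := x) (r := r) (p := []) (q := u) hD
    (hS u hu)

theorem mul_rel_mem_relSpan {i j : X} (hD : D i j) {a : A}
    (ha : a ∈ Submodule.span k (mon x '' S)) (hS : ∀ u ∈ S, u ++ [i, j] ∈ S') :
    a * r i j ∈ relSpan k x D r S' := by
  refine (Submodule.span_le (p := (relSpan k x D r S').comap (LinearMap.mulRight k (r i j)))).2
    ?_ ha
  rintro _ ⟨u, hu, rfl⟩
  simpa using mon_mul_rel_mul_mon_mem (k := k) (x := x) (r := r) (p := u) (q := []) hD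
    (hS u hu)

theorem mem_relSpan_of_mem_span (hx : Submodule.span k (Set.range (mon x)) = ⊤) {s : Set A}
    (hs : s ⊆ relSpan k x D r Set.univ) {a : A} (ha : a ∈ TwoSidedIdeal.span s) :
    a ∈ relSpan k x D r Set.univ := by
  have mul_mem_left : ∀ {a b}, b ∈ relSpan k x D r Set.univ → a * b ∈ relSpan k x D r Set.univ := by
    intro a b hb
    refine (Submodule.span_le (p := (relSpan k x D r Set.univ).comap (LinearMap.mulRight k b))).2
      ?_ (hx ▸ Submodule.mem_top : a ∈ Submodule.span k (Set.range (mon x)))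
    rintro _ ⟨p, rfl⟩
    exact mon_mul_mem_relSpan hb fun _ _ => trivial
  have mul_mem_right : ∀ {a b}, a ∈ relSpan k x D r Set.univ →
      a * b ∈ relSpan k x D r Set.univ := by
    intro a b ha
    refine (Submodule.span_le (p := (relSpan k x D r Set.univ).comap (LinearMap.mulLeft k a))).2
      ?_ (hx ▸ Submodule.mem_top : b ∈ Submodule.span k (Set.range (mon x)))
    rintro _ ⟨q, rfl⟩
    exact mul_mon_mem_relSpan ha fun _ _ => trivial
  let I := TwoSidedIdeal.mk' (relSpan k x D r Set.univ : Set A) (zero_mem _) add_mem neg_mem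
    mul_mem_left mul_mem_right
  have span_le : TwoSidedIdeal.span s ≤ I :=
    TwoSidedIdeal.span_le.2 fun a ha => (TwoSidedIdeal.mem_mk' ..).2 (hs ha)
  exact (TwoSidedIdeal.mem_mk' ..).1 (span_le ha)

variable [LinearOrder X]

/-- The relations `r i j`, for `i`, `j` with `D i j`, have the leading terms `c i j • x i * x j`,
and the ambiguity of reducing a word `[i, j, l]` at either end is resolved by smaller words. -/
structure IsConfluent (x : X → A) (D : X → X → Prop) (r : X → X → A) (c : X → X → k) :
    Prop where
  coeff_ne_zero : ∀ i j, D i j → c i j ≠ 0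
  lead : ∀ i j, D i j → c i j • mon x [i, j] - r i j ∈
    Submodule.span k (mon x '' {u | WordLT u [i, j]})
  overlap : ∀ i j l, D i j → D j l → c j l • (r i j * x l) - c i j • (x i * r j l) ∈
    relSpan k x D r {u | WordLT u [i, j, l]}

namespace IsConfluent

variable {c : X → X → k} (h : IsConfluent x D r c)
include h

theorem hasLeadingWord {i j : X} (hD : D i j) (p q : List X) :
    HasLeadingWord k x (mon x p * r i j * mon x q) (p ++ i :: j :: q) := by
  refine ⟨c i j, h.coeff_ne_zero i j hD, ?_⟩
  convert neg_mem (mon_mul_mem_span (p := p) (q := q) (S' := {u | WordLT u (p ++ i :: j :: q)})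
    (h.lead i j hD) fun u hu => by simpa using WordLT.append hu p q) using 1
  simp [mul_sub, sub_mul, mul_assoc]

theorem disjoint_mem {i j l m : X} (hij : D i j) (hlm : D l m) (s : List X) :
    c l m • (r i j * mon x (s ++ [l, m])) - c i j • (mon x (i :: j :: s) * r l m) ∈
      relSpan k x D r {u | WordLT u (i :: j :: (s ++ [l, m]))} := by
  have left_mem : mon x s * (c l m • mon x [l, m] - r l m) ∈
      Submodule.span k (mon x '' {u | WordLT u (s ++ [l, m])}) := by
    simpa only [mon_nil, mul_one] using mon_mul_mem_span (p := s) (q := []) (h.lead l m hlm)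
      fun u hu => by simpa using WordLT.append hu s []
  have right_mem : (c i j • mon x [i, j] - r i j) * mon x s ∈
      Submodule.span k (mon x '' {u | WordLT u (i :: j :: s)}) := by
    simpa only [mon_nil, one_mul] using mon_mul_mem_span (p := []) (q := s) (h.lead i j hij)
      fun u hu => by simpa using WordLT.append hu [] s
  convert sub_mem
    (rel_mul_mem_relSpan (r := r) (S' := {u | WordLT u (i :: j :: (s ++ [l, m]))}) hij left_mem
      fun u hu => by simpa using WordLT.append hu [i, j] [])
    (mul_rel_mem_relSpan hlm right_mem fun u hu => by simpa using WordLT.append hu [] [l, m])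
    using 1
  simp only [mon_cons, mon_append, mon_nil, mul_one, mul_sub, sub_mul, mul_smul_comm,
    smul_mul_assoc, mul_assoc]
  abel

theorem ambiguity_mem {t q q' : List X} {i j l m : X} (hij : D i j) (hlm : D l m)
    (hq : i :: j :: q = t ++ l :: m :: q') :
    c l m • (r i j * mon x q) - c i j • (mon x t * r l m * mon x q') ∈
      relSpan k x D r {u | WordLT u (i :: j :: q)} := by
  match t, hq with
  | [], hq =>
    obtain ⟨rfl, rfl, rfl⟩ := by simpa using hq
    simp
  | [a], hq =>
    obtain ⟨rfl, rfl, rfl⟩ := by simpa using hq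
    simpa [sub_mul, mul_assoc] using mul_mon_mem_relSpan (q := q') (h.overlap i j m hij hlm)
      fun u hu => by simpa using WordLT.append hu [] q'
  | a :: b :: s, hq =>
    obtain ⟨rfl, rfl, rfl⟩ := by simpa using hq
    simpa [sub_mul, mul_assoc] using mul_mon_mem_relSpan (q := q') (h.disjoint_mem hij hlm s)
      fun u hu => by simpa using WordLT.append hu [] q'

theorem smul_sub_smul_mem {p q p' q' : List X} {i j l m : X} (hij : D i j) (hlm : D l m)
    (hw : p ++ i :: j :: q = p' ++ l :: m :: q') :
    c l m • (mon x p * r i j * mon x q) - c i j • (mon x p' * r l m * mon x q') ∈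
      relSpan k x D r {u | WordLT u (p ++ i :: j :: q)} := by
  rcases List.append_eq_append_iff.1 hw with ⟨t, rfl, hq⟩ | ⟨t, rfl, hq⟩
  · simpa [mul_sub, mul_assoc] using mon_mul_mem_relSpan (p := p) (h.ambiguity_mem hij hlm hq)
      fun u hu => by simpa using WordLT.append hu p []
  · rw [hw, ← neg_sub]
    refine neg_mem ?_
    simpa [mul_sub, mul_assoc] using mon_mul_mem_relSpan (p := p') (h.ambiguity_mem hlm hij hq)
      fun u hu => by simpa using WordLT.append hu p' []

/-- By confluence, all multiples of relations with the same leading word agree up to smaller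
ones. -/
theorem exists_relSpan_le_span [WellFoundedGT X] :
    ∃ ρ : {w // ¬ NormalWord D w} → A, (∀ w, HasLeadingWord k x (ρ w) w.1) ∧
      relSpan k x D r Set.univ ≤ Submodule.span k (Set.range ρ) := by
  choose p i j q hw hD using fun w : {w // ¬ NormalWord D w} => not_normalWord_iff.1 w.2
  let ρ := fun w => mon x (p w) * r (i w) (j w) * mon x (q w)
  have rel_mem : ∀ w, relSpan k x D r {w} ≤ Submodule.span k (Set.range ρ) := by
    intro w
    induction w using (isReductionOrder_wordLT (X := X)).wf.induction with
    | _ w ih =>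
    have lower_le : relSpan k x D r {u | WordLT u w} ≤ Submodule.span k (Set.range ρ) := by
      refine Submodule.span_le.2 ?_
      rintro _ ⟨p, i, j, q, hD, hlt, rfl⟩
      exact ih _ hlt (mon_mul_rel_mul_mon_mem hD rfl)
    refine Submodule.span_le.2 ?_
    rintro _ ⟨p', i', j', q', hD', rfl, rfl⟩
    let w : {w // ¬ NormalWord D w} :=
      ⟨p' ++ i' :: j' :: q', not_normalWord_iff.2 ⟨p', i', j', q', rfl, hD'⟩⟩
    have sub_mem := lower_le (h.smul_sub_smul_mem hD' (hD w) (hw w))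
    rw [SetLike.mem_coe, ← Submodule.smul_mem_iff _ (h.coeff_ne_zero _ _ (hD w))]
    exact (Submodule.sub_mem_iff_left _ (Submodule.smul_mem _ _
      (Submodule.subset_span (Set.mem_range_self w)))).1 sub_mem
  refine ⟨ρ, fun w => hw w ▸ h.hasLeadingWord (hD w) (p w) (q w), Submodule.span_le.2 ?_⟩
  rintro _ ⟨p, i, j, q, hD, -, rfl⟩
  exact rel_mem _ (mon_mul_rel_mul_mon_mem hD rfl)

theorem exists_hasLeadingWord [WellFoundedGT X] {f : A} (hf : f ∈ relSpan k x D r Set.univ)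
    (hf0 : f ≠ 0) : ∃ w, ¬ NormalWord D w ∧ HasLeadingWord k x f w := by
  obtain ⟨ρ, hρ, hle⟩ := h.exists_relSpan_le_span
  obtain ⟨a, rfl⟩ := Finsupp.mem_span_range_iff_exists_finsupp.1 (hle hf)
  obtain ⟨w, hw⟩ := hasLeadingWord_linearCombination Subtype.val_injective hρ (c := a)
    (by rintro rfl; simp at hf0)
  exact ⟨w.1, w.2, hw⟩

theorem disjoint_normalWord [WellFoundedGT X] (hx : LinearIndependent k (mon x)) :
    Disjoint (Submodule.span k (Set.range fun w : {w // NormalWord D w} => mon x w.1))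
      (relSpan k x D r Set.univ) := by
  refine Submodule.disjoint_def.2 fun f hf hf' => ?_
  by_contra hf0
  obtain ⟨w, hw, hfw⟩ := h.exists_hasLeadingWord hf' hf0
  obtain ⟨a, rfl⟩ := Finsupp.mem_span_range_iff_exists_finsupp.1 hf
  obtain ⟨v, hv⟩ := hasLeadingWord_linearCombination (k := k) Subtype.val_injective
    (fun v : {w // NormalWord D w} => hasLeadingWord_mon x v.1) (c := a)
    (by rintro rfl; simp at hf0)
  exact hw (hfw.unique hx hv ▸ v.2)

end IsConfluent

end DiamondLemma

/-! ### Confluence for color Lie algebras -/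

namespace CommutationFactor

variable {k Γ : Type*} [Field k] [AddCommGroup Γ] (ε : CommutationFactor k Γ)

theorem coe_mul_swap (α β : Γ) : (ε α β : k) * ε β α = 1 := by
  rw [← Units.val_mul, ε.mul_swap, Units.val_one]

theorem coe_add_left (α β γ : Γ) : (ε (α + β) γ : k) = ε α γ * ε β γ := by
  rw [ε.add_left, Units.val_mul]

theorem coe_add_right (α β γ : Γ) : (ε α (β + γ) : k) = ε α β * ε α γ := by
  rw [ε.add_right, Units.val_mul]

theorem self_eq_one_or_neg_one (α : Γ) : (ε α α : k) = 1 ∨ (ε α α : k) = -1 :=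
  mul_self_eq_one_iff.1 (ε.coe_mul_swap α α)

end CommutationFactor

namespace ColorLieAlgebra

open TensorAlgebra

variable {k Γ : Type*} [Field k] [AddCommGroup Γ] {ε : CommutationFactor k Γ}
  {g : Type*} [AddCommGroup g] [Module k g] (L : ColorLieAlgebra ε g)

theorem commRel_mem_relations {α β : Γ} {a b : g} (ha : a ∈ L.comp α) (hb : b ∈ L.comp β) :
    L.commRel α β a b ∈ L.relations :=
  Submodule.subset_span ⟨α, β, a, ha, b, hb, rfl⟩

theorem commRel_swap {α β : Γ} {a b : g} (ha : a ∈ L.comp α) (hb : b ∈ L.comp β) :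
    L.commRel β α b a = -((ε β α : k) • L.commRel α β a b) := by
  have bracket_ba : L.bracket b a = -((ε β α : k) • L.bracket a b) := L.bracket_skew hb ha
  have ε_swap := ε.coe_mul_swap β α
  simp only [commRel, bracket_ba, map_neg, map_smul]
  linear_combination (norm := module) (-ε_swap) • (ι k b * ι k a)

theorem bracket_self_eq_zero (h2 : (2 : k) ≠ 0) {α : Γ} {a : g} (ha : a ∈ L.comp α)
    (hε : (ε α α : k) = 1) : L.bracket a a = 0 := by
  have skew := L.bracket_skew ha ha
  rw [hε, one_smul, eq_neg_iff_add_eq_zero, ← two_smul k] at skew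
  exact (smul_eq_zero.1 skew).resolve_left h2

theorem commRel_self_eq_zero (h2 : (2 : k) ≠ 0) {α : Γ} {a : g} (ha : a ∈ L.comp α)
    (hε : (ε α α : k) = 1) : L.commRel α α a a = 0 := by
  simp [commRel, L.bracket_self_eq_zero h2 ha hε, hε]

theorem bracket_bracket {α β γ : Γ} {a b c : g} (ha : a ∈ L.comp α) (hb : b ∈ L.comp β)
    (hc : c ∈ L.comp γ) :
    L.bracket (L.bracket a b) c =
      L.bracket a (L.bracket b c) - (ε α β : k) • L.bracket b (L.bracket a c) := by
  have jacobi := L.jacobi ha hb hc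
  have ε_swap := ε.coe_mul_swap α γ
  rw [L.bracket_skew (L.bracket_mem ha hb) hc, L.bracket_skew ha hc, ε.coe_add_left]
  simp only [map_neg, map_smul]
  linear_combination (norm := module)
    (-(ε α γ : k)) • jacobi + ε_swap • L.bracket a (L.bracket b c)

/-- The two ways of reversing a product of three homogeneous elements agree modulo relations of
lower degree. -/
theorem hexagon_mem_relations {α β γ : Γ} {a b c : g} (ha : a ∈ L.comp α) (hb : b ∈ L.comp β)
    (hc : c ∈ L.comp γ) :
    L.commRel α β a b * ι k c + (ε α β : k) • (ι k b * L.commRel α γ a c)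
      + ((ε α β : k) * ε α γ) • (L.commRel β γ b c * ι k a)
      - ι k a * L.commRel β γ b c - (ε β γ : k) • (L.commRel α γ a c * ι k b)
      - ((ε β γ : k) * ε α γ) • (ι k c * L.commRel α β a b) ∈ L.relations := by
  have hexagon : L.commRel α β a b * ι k c + (ε α β : k) • (ι k b * L.commRel α γ a c)
      + ((ε α β : k) * ε α γ) • (L.commRel β γ b c * ι k a)
      - ι k a * L.commRel β γ b c - (ε β γ : k) • (L.commRel α γ a c * ι k b)
      - ((ε β γ : k) * ε α γ) • (ι k c * L.commRel α β a b) =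
      -L.commRel (α + β) γ (L.bracket a b) c + L.commRel α (β + γ) a (L.bracket b c)
        - (ε α β : k) • L.commRel β (α + γ) b (L.bracket a c) := by
    have ε_swap := ε.coe_mul_swap α β
    simp only [commRel, L.bracket_bracket ha hb hc, ε.coe_add_left, ε.coe_add_right, map_sub,
      map_smul, mul_sub, sub_mul, mul_smul_comm, smul_mul_assoc, mul_assoc]
    linear_combination (norm := module)
      (-(ε β γ : k) * ε_swap) • (ι k (L.bracket a c) * ι k b)
  rw [hexagon]
  exact sub_mem (add_mem
    (neg_mem (L.commRel_mem_relations (L.bracket_mem ha hb) hc))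
    (L.commRel_mem_relations ha (L.bracket_mem hb hc)))
    (Submodule.smul_mem _ _ (L.commRel_mem_relations hb (L.bracket_mem ha hc)))

variable {n : ℕ} (b : Module.Basis (Fin n) k g) (deg : Fin n → Γ)

/-- The pairs of basis elements whose product is rewritten, see `RelIndex`. -/
def Defect (ε : CommutationFactor k Γ) (deg : Fin n → Γ) (i j : Fin n) : Prop :=
  i < j ∨ (i = j ∧ (ε (deg i) (deg i) : k) = -1)

/-- The generators of the tensor algebra attached to a basis. -/
noncomputable def letter (i : Fin n) : TensorAlgebra k g := ι k (b i)

/-- The relation `b i b j - ε(deg i, deg j) b j b i - ⟨b i, b j⟩` for an arbitrary pair of basis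
elements. -/
noncomputable def letterRel (i j : Fin n) : TensorAlgebra k g :=
  L.commRel (deg i) (deg j) (b i) (b j)

theorem tensorAlgebra_basis_comp_ofList :
    b.tensorAlgebra ∘ FreeMonoid.ofList = mon (letter b) := by
  have basis_free (w : List (Fin n)) :
      FreeAlgebra.basisFreeMonoid k (Fin n) (FreeMonoid.ofList w) = mon (FreeAlgebra.ι k) w := by
    simp [FreeAlgebra.basisFreeMonoid, FreeAlgebra.equivMonoidAlgebraFreeMonoid, mon,
      FreeMonoid.lift_apply]
  have letter_eq : (equivFreeAlgebra b).symm ∘ FreeAlgebra.ι k = letter b :=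
    funext (equivFreeAlgebra_symm_ι b)
  funext w
  rw [Function.comp_apply, Module.Basis.tensorAlgebra, Module.Basis.map_apply, basis_free,
    AlgEquiv.toLinearEquiv_apply, map_mon, letter_eq]

theorem linearIndependent_mon_letter : LinearIndependent k (mon (letter b)) :=
  tensorAlgebra_basis_comp_ofList b ▸
    b.tensorAlgebra.linearIndependent.comp _ FreeMonoid.ofList.injective

theorem span_range_mon_letter : Submodule.span k (Set.range (mon (letter b))) = ⊤ := by
  rw [← tensorAlgebra_basis_comp_ofList, EquivLike.range_comp, b.tensorAlgebra.span_eq]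

theorem ι_mem_span_mon_letter (v : g) :
    ι k v ∈ Submodule.span k (mon (letter b) '' {u | u.length = 1}) := by
  rw [← span_range_pow, pow_one,
    show Set.range (letter b) = ι k '' Set.range b from Set.range_comp _ _, ← Submodule.map_span,
    b.span_eq]
  exact ⟨v, trivial, rfl⟩

/-- The leading coefficient of `letterRel i j`: on the diagonal the leading word occurs twice. -/
def leadCoeff (k : Type*) [Field k] (i j : Fin n) : k := if i = j then 2 else 1

theorem leadCoeff_self (i : Fin n) : leadCoeff k i i = 2 := if_pos rfl

theorem leadCoeff_of_lt {i j : Fin n} (h : i < j) : leadCoeff k i j = 1 := if_neg h.ne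

variable {deg}

theorem leadCoeff_ne_zero (h2 : (2 : k) ≠ 0) (i j : Fin n) : leadCoeff k i j ≠ 0 := by
  rw [leadCoeff]
  split_ifs
  exacts [h2, one_ne_zero]

theorem leadCoeff_smul_mon_sub_mem {i j : Fin n} (hD : Defect ε deg i j) :
    leadCoeff k i j • mon (letter b) [i, j] - L.letterRel b deg i j - ι k (L.bracket (b i) (b j)) ∈
      Submodule.span k (mon (letter b) '' {u | LexLT u [i, j]}) := by
  rcases hD with hlt | ⟨rfl, hε⟩
  · rw [leadCoeff_of_lt hlt]
    have mon_swap_mem : mon (letter b) [j, i] ∈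
        Submodule.span k (mon (letter b) '' {u | LexLT u [i, j]}) :=
      Submodule.subset_span ⟨[j, i], LexLT.of_lt hlt (p := []) rfl, rfl⟩
    convert Submodule.smul_mem _ (ε (deg i) (deg j) : k) mon_swap_mem using 1
    simp only [letterRel, commRel, letter, mon_cons, mon_nil, mul_one, one_smul]
    abel
  · convert zero_mem (Submodule.span k (mon (letter b) '' {u | LexLT u [i, i]})) using 1
    simp [letterRel, commRel, letter, hε, leadCoeff_self, two_smul]

variable {b} (hb : ∀ i, b i ∈ L.comp (deg i))
include hb

theorem comp_le_span (α : Γ) : L.comp α ≤ Submodule.span k (b '' {i | deg i = α}) := by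
  intro a ha
  have span_sup_span : Submodule.span k (b '' {i | deg i = α}) ⊔
      Submodule.span k (b '' {i | deg i = α}ᶜ) = ⊤ := by
    rw [← Submodule.span_union, ← Set.image_union, Set.union_compl_self, Set.image_univ, b.span_eq]
  obtain ⟨s, hs, t, ht, rfl⟩ := Submodule.mem_sup.1 (span_sup_span ▸ Submodule.mem_top : a ∈ _)
  have s_mem : s ∈ L.comp α := by
    refine Submodule.span_le.2 ?_ hs
    rintro _ ⟨i, rfl, rfl⟩
    exact hb i
  have t_mem : t ∈ ⨆ (γ) (_ : γ ≠ α), L.comp γ := by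
    refine Submodule.span_le.2 ?_ ht
    rintro _ ⟨i, hi, rfl⟩
    exact Submodule.mem_iSup_of_mem (deg i) (Submodule.mem_iSup_of_mem hi (hb i))
  have t_eq_zero : t = 0 := Submodule.disjoint_def.1 (L.comp_indep α) t
    ((Submodule.add_mem_iff_right _ s_mem).1 ha) t_mem
  rwa [t_eq_zero, add_zero]

theorem relations_eq_span_letterRel :
    L.relations =
      Submodule.span k (Set.range fun p : Fin n × Fin n => L.letterRel b deg p.1 p.2) := by
  let commRelHom (α β : Γ) : g →ₗ[k] g →ₗ[k] TensorAlgebra k g := LinearMap.mk₂ k (L.commRel α β)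
    (fun _ _ _ => by simp only [commRel, map_add, mul_add, add_mul, LinearMap.add_apply]; module)
    (fun _ _ _ => by
      simp only [commRel, map_smul, mul_smul_comm, smul_mul_assoc, LinearMap.smul_apply]; module)
    (fun _ _ _ => by simp only [commRel, map_add, mul_add, add_mul]; module)
    (fun _ _ _ => by simp only [commRel, map_smul, mul_smul_comm, smul_mul_assoc]; module)
  refine le_antisymm (Submodule.span_le.2 ?_) (Submodule.span_le.2 ?_)
  · rintro _ ⟨α, β, a, ha, c, hc, rfl⟩
    have mem_map₂ := Submodule.apply_mem_map₂ (commRelHom α β) (L.comp_le_span hb α ha)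
      (L.comp_le_span hb β hc)
    rw [Submodule.map₂_span_span] at mem_map₂
    refine Submodule.span_mono ?_ mem_map₂
    rintro _ ⟨_, ⟨i, rfl, rfl⟩, _, ⟨j, rfl, rfl⟩, rfl⟩
    exact ⟨(i, j), rfl⟩
  · rintro _ ⟨⟨i, j⟩, rfl⟩
    exact L.commRel_mem_relations (hb i) (hb j)

theorem span_basisRel (h2 : (2 : k) ≠ 0) :
    Submodule.span k (Set.range (L.basisRel b deg)) = L.relations := by
  rw [L.relations_eq_span_letterRel hb]
  refine le_antisymm (Submodule.span_mono ?_) (Submodule.span_le.2 ?_)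
  · rintro _ ⟨p, rfl⟩
    exact ⟨p.1, rfl⟩
  rintro _ ⟨⟨i, j⟩, rfl⟩
  change L.letterRel b deg i j ∈ _
  have letterRel_mem {i j : Fin n} (hD : Defect ε deg i j) :
      L.letterRel b deg i j ∈ Submodule.span k (Set.range (L.basisRel b deg)) :=
    Submodule.subset_span ⟨⟨(i, j), hD⟩, rfl⟩
  rcases lt_trichotomy i j with hlt | rfl | hlt
  · exact letterRel_mem (.inl hlt)
  · rcases ε.self_eq_one_or_neg_one (deg i) with hε | hε
    · have rel_eq_zero : L.letterRel b deg i i = 0 := L.commRel_self_eq_zero h2 (hb i) hε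
      exact rel_eq_zero ▸ zero_mem _
    · exact letterRel_mem (.inr ⟨rfl, hε⟩)
  · have rel_swap : L.letterRel b deg i j = -((ε (deg i) (deg j) : k) • L.letterRel b deg j i) :=
      L.commRel_swap (hb j) (hb i)
    exact rel_swap ▸ neg_mem (Submodule.smul_mem _ _ (letterRel_mem (.inl hlt)))

theorem relations_le_relSpan (h2 : (2 : k) ≠ 0) {S : Set (List (Fin n))}
    (hS : ∀ u, u.length = 2 → u ∈ S) :
    L.relations ≤ relSpan k (letter b) (Defect ε deg) (L.letterRel b deg) S := by
  rw [← L.span_basisRel hb h2, Submodule.span_le]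
  rintro _ ⟨⟨⟨i, j⟩, hD⟩, rfl⟩
  have mem := mon_mul_rel_mul_mon_mem (k := k) (x := letter b) (D := Defect ε deg)
    (r := L.letterRel b deg) (p := []) (q := []) hD (hS _ rfl)
  rwa [mon_nil, one_mul, mul_one] at mem

theorem hexagon_mem_relSpan (h2 : (2 : k) ≠ 0) (i j l : Fin n) :
    L.letterRel b deg i j * letter b l
      + (ε (deg i) (deg j) : k) • (letter b j * L.letterRel b deg i l)
      + ((ε (deg i) (deg j) : k) * ε (deg i) (deg l)) • (L.letterRel b deg j l * letter b i)
      - letter b i * L.letterRel b deg j l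
      - (ε (deg j) (deg l) : k) • (L.letterRel b deg i l * letter b j)
      - ((ε (deg j) (deg l) : k) * ε (deg i) (deg l)) • (letter b l * L.letterRel b deg i j) ∈
      relSpan k (letter b) (Defect ε deg) (L.letterRel b deg) {u | WordLT u [i, j, l]} :=
  L.relations_le_relSpan hb h2 (fun u hu => List.Shortlex.of_length_lt (by simp [hu]))
    (L.hexagon_mem_relations (hb i) (hb j) (hb l))

theorem overlap_mem_relSpan (h2 : (2 : k) ≠ 0) (h3 : (3 : k) ≠ 0) {i j l : Fin n}
    (hij : Defect ε deg i j) (hjl : Defect ε deg j l) :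
    leadCoeff k j l • (L.letterRel b deg i j * letter b l) -
      leadCoeff k i j • (letter b i * L.letterRel b deg j l) ∈
        relSpan k (letter b) (Defect ε deg) (L.letterRel b deg) {u | WordLT u [i, j, l]} := by
  have hexagon := L.hexagon_mem_relSpan hb h2 i j l
  have mul_mem (p) {q r} (s : k) (hqr : Defect ε deg q r) (lt : LexLT [p, q, r] [i, j, l]) :=
    Submodule.smul_mem _ s (gen_mul_rel_mem_relSpan (k := k) (x := letter b)
      (r := L.letterRel b deg) (S := {u | WordLT u [i, j, l]}) p hqr lt.wordLT)
  have mem_mul {p q} (r) (s : k) (hpq : Defect ε deg p q) (lt : LexLT [p, q, r] [i, j, l]) :=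
    Submodule.smul_mem _ s (rel_mul_gen_mem_relSpan (k := k) (x := letter b)
      (r := L.letterRel b deg) (S := {u | WordLT u [i, j, l]}) hpq r lt.wordLT)
  rcases hij with lt_ij | ⟨rfl, ε_ii⟩ <;> rcases hjl with lt_jl | ⟨rfl, ε_jj⟩
  · have lt_il := lt_ij.trans lt_jl
    rw [leadCoeff_of_lt lt_ij, leadCoeff_of_lt lt_jl]
    convert sub_mem (add_mem (add_mem hexagon
        (mem_mul j (ε (deg j) (deg l)) (.inl lt_il) (.of_lt lt_jl (p := [i]) rfl)))
        (mul_mem l (ε (deg j) (deg l) * ε (deg i) (deg l)) (.inl lt_ij)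
          (.of_lt lt_il (p := []) rfl)))
      (add_mem (mul_mem j (ε (deg i) (deg j)) (.inl lt_il) (.of_lt lt_ij (p := []) rfl))
        (mem_mul i (ε (deg i) (deg j) * ε (deg i) (deg l)) (.inl lt_jl)
          (.of_lt lt_ij (p := []) rfl))) using 1
    module
  · rw [leadCoeff_of_lt lt_ij, leadCoeff_self]
    convert sub_mem hexagon (add_mem
      (mul_mem j (2 * ε (deg i) (deg j)) (.inl lt_ij) (.of_lt lt_ij (p := []) rfl))
      (mem_mul i (ε (deg i) (deg j) * ε (deg i) (deg j)) (.inr ⟨rfl, ε_jj⟩)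
        (.of_lt lt_ij (p := []) rfl))) using 1
    simp only [ε_jj]
    module
  · rw [leadCoeff_of_lt lt_jl, leadCoeff_self]
    convert add_mem hexagon (add_mem
      (mem_mul i (2 * ε (deg i) (deg l)) (.inl lt_jl) (.of_lt lt_jl (p := [i]) rfl))
      (mul_mem l (ε (deg i) (deg l) * ε (deg i) (deg l)) (.inr ⟨rfl, ε_ii⟩)
        (.of_lt lt_jl (p := []) rfl))) using 1
    simp only [ε_ii]
    module
  · rw [leadCoeff_self, ← Submodule.smul_mem_iff _ h3]
    convert Submodule.smul_mem _ (2 : k) hexagon using 1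
    simp only [ε_ii]
    module

theorem isConfluent (h2 : (2 : k) ≠ 0) (h3 : (3 : k) ≠ 0) :
    IsConfluent (letter b) (Defect ε deg) (L.letterRel b deg) (leadCoeff k) where
  coeff_ne_zero i j _ := leadCoeff_ne_zero h2 i j
  lead i j hD := by
    rw [← sub_add_cancel (leadCoeff k i j • mon (letter b) [i, j] - L.letterRel b deg i j)
      (ι k (L.bracket (b i) (b j)))]
    refine add_mem (Submodule.span_mono (Set.image_mono fun u hu => hu.wordLT)
      (L.leadCoeff_smul_mon_sub_mem b hD)) ?_
    refine Submodule.span_mono (Set.image_mono fun u hu => ?_) (ι_mem_span_mon_letter b _)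
    exact List.Shortlex.of_length_lt (by simp_all)
  overlap _ _ _ hij hjl := L.overlap_mem_relSpan hb h2 h3 hij hjl

end ColorLieAlgebra

/-! ### The universal enveloping algebra -/

namespace ColorLieAlgebra

open TensorAlgebra

variable {k Γ : Type*} [Field k] [AddCommGroup Γ] {ε : CommutationFactor k Γ}
  {g : Type*} [AddCommGroup g] [Module k g] (L : ColorLieAlgebra ε g)

theorem lift_envι : TensorAlgebra.lift k L.envι = RingQuot.mkAlgHom k L.EnvRel := by
  ext v
  simp [envι]

theorem lift_envι_surjective : Function.Surjective (TensorAlgebra.lift k L.envι) :=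
  L.lift_envι ▸ RingQuot.mkAlgHom_surjective _ _

theorem lift_envι_commRel {α β : Γ} {a b : g} (ha : a ∈ L.comp α) (hb : b ∈ L.comp β) :
    TensorAlgebra.lift k L.envι (L.commRel α β a b) = 0 := by
  rw [lift_envι, commRel, sub_sub, map_sub, sub_eq_zero]
  exact RingQuot.mkAlgHom_rel k (EnvRel.comm ha hb)

theorem ker_lift_envι : TwoSidedIdeal.ker (TensorAlgebra.lift k L.envι) =
    TwoSidedIdeal.span (L.relations : Set (TensorAlgebra k g)) := by
  refine le_antisymm (fun y hy => ?_) (TwoSidedIdeal.span_le.2 fun y hy => ?_)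
  · set J := TwoSidedIdeal.span (L.relations : Set (TensorAlgebra k g))
    have mem_J (z : TensorAlgebra k g) : z ∈ J ↔ J.ringCon.mk' z = 0 := by
      rw [← TwoSidedIdeal.mem_ker, TwoSidedIdeal.ker_ringCon_mk']
    have mk_eq_of_envRel ⦃u v⦄ (huv : L.EnvRel u v) : J.ringCon.mk' u = J.ringCon.mk' v := by
      obtain ⟨ha, hb⟩ := huv
      rw [← sub_eq_zero, ← map_sub, ← mem_J, ← sub_sub]
      exact TwoSidedIdeal.subset_span (L.commRel_mem_relations ha hb)
    rw [TwoSidedIdeal.mem_ker, lift_envι, ← AlgHom.coe_toRingHom, RingQuot.mkAlgHom_coe] at hy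
    rw [mem_J, ← RingQuot.lift_mkRingHom_apply J.ringCon.mk' mk_eq_of_envRel, hy, map_zero]
  · have relations_le_ker :
        L.relations ≤ LinearMap.ker (TensorAlgebra.lift k L.envι).toLinearMap := by
      refine Submodule.span_le.2 ?_
      rintro _ ⟨α, β, a, ha, b, hb, rfl⟩
      exact L.lift_envι_commRel ha hb
    exact (TwoSidedIdeal.mem_ker _).2 (relations_le_ker hy)

theorem ι_mem_tensorDeg (v : g) : ι k v ∈ tensorDeg k g 1 := by
  rw [tensorDeg, pow_one]
  exact LinearMap.mem_range_self _ v

theorem ι_mul_ι_sub_smul_mem_tensorDeg (a b : g) (c : k) :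
    ι k a * ι k b - c • (ι k b * ι k a) ∈ tensorDeg k g 2 := by
  have ι_mul_ι_mem (u v : g) : ι k u * ι k v ∈ tensorDeg k g 2 := by
    rw [tensorDeg, pow_two]
    exact Submodule.mul_mem_mul (LinearMap.mem_range_self _ u) (LinearMap.mem_range_self _ v)
  exact sub_mem (ι_mul_ι_mem a b) (Submodule.smul_mem _ c (ι_mul_ι_mem b a))

theorem relations_le_tensorDeg : L.relations ≤ tensorDeg k g 1 ⊔ tensorDeg k g 2 := by
  refine Submodule.span_le.2 ?_
  rintro _ ⟨α, β, a, -, b, -, rfl⟩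
  exact sub_mem (Submodule.mem_sup_right (ι_mul_ι_sub_smul_mem_tensorDeg a b _))
    (Submodule.mem_sup_left (ι_mem_tensorDeg _))

section UniversalProperty

variable {A : Type*} [Ring A] [Algebra k A]

/-- The universal property of `U(g)`: the algebra homomorphism that extends a linear map whose
values satisfy the commutation relations of `g`. -/
noncomputable def envLift (f : g →ₗ[k] A)
    (hf : ∀ ⦃α β : Γ⦄ ⦃a b : g⦄, a ∈ L.comp α → b ∈ L.comp β →
      f a * f b = (ε α β : k) • (f b * f a) + f (L.bracket a b)) : L.Env →ₐ[k] A :=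
  RingQuot.liftAlgHom k ⟨TensorAlgebra.lift k f, by
    rintro _ _ ⟨ha, hb⟩
    simpa using hf ha hb⟩

variable {L} in
theorem envLift_lift_envι {f : g →ₗ[k] A} (hf) (t : TensorAlgebra k g) :
    L.envLift f hf (TensorAlgebra.lift k L.envι t) = TensorAlgebra.lift k f t := by
  rw [lift_envι, envLift, RingQuot.liftAlgHom_mkAlgHom_apply]

variable {L} in
theorem envLift_envι {f : g →ₗ[k] A} (hf) (v : g) : L.envLift f hf (L.envι v) = f v := by
  simpa only [TensorAlgebra.lift_ι_apply] using envLift_lift_envι hf (ι k v)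

variable {L} in
theorem env_algHom_ext {φ ψ : L.Env →ₐ[k] A} (h : ∀ v, φ (L.envι v) = ψ (L.envι v)) : φ = ψ :=
  RingQuot.ringQuot_ext' k _ _ (TensorAlgebra.hom_ext (LinearMap.ext h))

end UniversalProperty

/-- The augmentation `U(g) → k`, the algebra homomorphism that vanishes on `g`. -/
noncomputable def augmentation : L.Env →ₐ[k] k := L.envLift 0 fun _ _ _ _ _ _ => by simp

theorem augmentation_lift_envι (t : TensorAlgebra k g) :
    L.augmentation (TensorAlgebra.lift k L.envι t) = TensorAlgebra.lift k 0 t :=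
  envLift_lift_envι _ t

theorem sub_algebraMap_augmentation_mem (y : L.Env) :
    y - algebraMap k L.Env (L.augmentation y) ∈ TwoSidedIdeal.span (Set.range L.envι) := by
  obtain ⟨t, rfl⟩ := L.lift_envι_surjective y
  rw [augmentation_lift_envι]
  induction t using TensorAlgebra.induction with
  | algebraMap r =>
    rw [AlgHom.commutes, AlgHom.commutes, Algebra.algebraMap_self_apply, sub_self]
    exact zero_mem _
  | ι v =>
    rw [TensorAlgebra.lift_ι_apply, TensorAlgebra.lift_ι_apply, LinearMap.zero_apply, map_zero,
      sub_zero]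
    exact TwoSidedIdeal.subset_span (Set.mem_range_self v)
  | mul s t hs ht =>
    rw [map_mul, map_mul, map_mul, ← sub_add_sub_cancel _
      (algebraMap k L.Env (TensorAlgebra.lift k (0 : g →ₗ[k] k) s) *
        TensorAlgebra.lift k L.envι t), ← sub_mul, ← mul_sub]
    exact add_mem (TwoSidedIdeal.mul_mem_right _ _ _ hs) (TwoSidedIdeal.mul_mem_left _ _ _ ht)
  | add s t hs ht =>
    rw [map_add, map_add, map_add, add_sub_add_comm]
    exact add_mem hs ht

theorem ker_augmentation :
    TwoSidedIdeal.ker L.augmentation = TwoSidedIdeal.span (Set.range L.envι) := by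
  refine le_antisymm (fun y hy => ?_) (TwoSidedIdeal.span_le.2 ?_)
  · simpa [(TwoSidedIdeal.mem_ker _).1 hy] using L.sub_algebraMap_augmentation_mem y
  · rintro _ ⟨v, rfl⟩
    simpa [TwoSidedIdeal.mem_ker] using L.augmentation_lift_envι (ι k v)

theorem exists_homogeneous_basis [FiniteDimensional k g] :
    ∃ (n : ℕ) (b : Module.Basis (Fin n) k g) (deg : Fin n → Γ), ∀ i, b i ∈ L.comp (deg i) := by
  have span_iUnion : ⊤ ≤ Submodule.span k (⋃ γ, (L.comp γ : Set g)) := by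
    rw [← L.comp_iSup, Submodule.iSup_eq_span]
  have homogeneous (i) : ∃ γ, Module.Basis.ofSpan span_iUnion i ∈ L.comp γ := by
    simpa only [Set.mem_iUnion, SetLike.mem_coe] using
      Module.Basis.ofSpan_subset span_iUnion (Set.mem_range_self i)
  generalize Module.Basis.ofSpan span_iUnion = b at homogeneous
  have finite_index := Module.Finite.finite_basis b
  obtain ⟨n, ⟨e⟩⟩ := @Finite.exists_equiv_fin _ finite_index
  choose deg hdeg using homogeneous
  exact ⟨n, b.reindex e, deg ∘ e.symm, fun i => by simpa using hdeg (e.symm i)⟩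

variable {n : ℕ}

theorem isLeadingMonomial_of_hasLeadingWord {b : Module.Basis (Fin n) k g}
    {f : TensorAlgebra k g} {w : List (Fin n)} (h : HasLeadingWord k (letter b) f w) :
    IsLeadingMonomial b f (FreeMonoid.ofList w) := by
  obtain ⟨c, hc, hf⟩ := h
  rw [← tensorAlgebra_basis_comp_ofList, Set.image_comp, Module.Basis.mem_span_image,
    Function.comp_apply, map_sub, map_smul, Module.Basis.repr_self] at hf
  have coord_eq {u : FreeMonoid (Fin n)} (hu : ¬ WordLT u.toList w) :
      b.tensorAlgebra.repr f u = c • Finsupp.single (FreeMonoid.ofList w) (1 : k) u := by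
    by_contra hne
    obtain ⟨v, hv, rfl⟩ := hf (Finsupp.mem_support_iff.2 (sub_ne_zero.2 hne))
    exact hu hv
  refine ⟨Finsupp.mem_support_iff.2 ?_, fun u hu hne => ?_⟩
  · rw [coord_eq (u := FreeMonoid.ofList w) (WordLT.irrefl w), Finsupp.single_eq_same]
    exact smul_ne_zero hc one_ne_zero
  · by_contra hlt
    refine Finsupp.mem_support_iff.1 hu ?_
    rw [coord_eq hlt, Finsupp.single_eq_of_ne hne, smul_zero]

theorem lift_envι_comp_letter (b : Module.Basis (Fin n) k g) :
    TensorAlgebra.lift k L.envι ∘ letter b = L.envι ∘ b :=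
  funext fun _ => TensorAlgebra.lift_ι_apply _ _

theorem lift_envι_comp_mon_letter (b : Module.Basis (Fin n) k g) :
    (TensorAlgebra.lift k L.envι).toLinearMap ∘ mon (letter b) = mon (L.envι ∘ b) :=
  funext fun w => by
    rw [Function.comp_apply, AlgHom.toLinearMap_apply, map_mon, lift_envι_comp_letter]

theorem span_range_mon_env (b : Module.Basis (Fin n) k g) :
    Submodule.span k (Set.range (mon (L.envι ∘ b))) = ⊤ := by
  rw [← lift_envι_comp_mon_letter, Set.range_comp, ← Submodule.map_span, span_range_mon_letter,
    Submodule.map_top, LinearMap.range_eq_top]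
  exact L.lift_envι_surjective

variable {b : Module.Basis (Fin n) k g} {deg : Fin n → Γ} (hb : ∀ i, b i ∈ L.comp (deg i))
include hb

theorem linearIndependent_basisRel (h2 : (2 : k) ≠ 0) (h3 : (3 : k) ≠ 0) :
    LinearIndependent k (L.basisRel b deg) := by
  refine linearIndependent_of_hasLeadingWord (W := fun p : RelIndex ε deg => [p.1.1, p.1.2])
    (linearIndependent_mon_letter b) (fun p q hpq => ?_) fun p => ?_
  · simpa [Subtype.ext_iff, Prod.ext_iff] using hpq
  · have leading := (L.isConfluent hb h2 h3).hasLeadingWord p.2 [] []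
    rwa [mon_nil, one_mul, mul_one] at leading

theorem ker_lift_envι_le_relSpan (h2 : (2 : k) ≠ 0) {f : TensorAlgebra k g}
    (hf : f ∈ TwoSidedIdeal.ker (TensorAlgebra.lift k L.envι)) :
    f ∈ relSpan k (letter b) (Defect ε deg) (L.letterRel b deg) Set.univ :=
  mem_relSpan_of_mem_span (span_range_mon_letter b)
    (L.relations_le_relSpan hb h2 fun _ _ => trivial) (L.ker_lift_envι ▸ hf)

theorem isGroebnerBasis (h2 : (2 : k) ≠ 0) (h3 : (3 : k) ≠ 0) :
    IsGroebnerBasis b (Set.range (L.basisRel b deg))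
      (TwoSidedIdeal.ker (TensorAlgebra.lift k L.envι)) := by
  have confluent := L.isConfluent hb h2 h3
  refine ⟨?_, fun f hf hf0 => ?_⟩
  · rintro _ ⟨p, rfl⟩
    exact (TwoSidedIdeal.mem_ker _).2 (L.lift_envι_commRel (hb _) (hb _))
  obtain ⟨w, hw, f_lead⟩ :=
    confluent.exists_hasLeadingWord (L.ker_lift_envι_le_relSpan hb h2 hf) hf0
  obtain ⟨p, i, j, q, rfl, hD⟩ := not_normalWord_iff.1 hw
  have rel_lead : HasLeadingWord k (letter b) (L.letterRel b deg i j) [i, j] := by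
    simpa using confluent.hasLeadingWord hD [] []
  exact ⟨_, isLeadingMonomial_of_hasLeadingWord f_lead, _, ⟨⟨(i, j), hD⟩, rfl⟩, _,
    isLeadingMonomial_of_hasLeadingWord rel_lead, FreeMonoid.ofList p, FreeMonoid.ofList q,
    FreeMonoid.toList.injective (by simp)⟩

theorem disjoint_span_normalWord_ker (h2 : (2 : k) ≠ 0) (h3 : (3 : k) ≠ 0) :
    Disjoint
      (Submodule.span k (Set.range fun w : {w // NormalWord (Defect ε deg) w} =>
        mon (letter b) w.1))
      (LinearMap.ker (TensorAlgebra.lift k L.envι).toLinearMap) :=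
  ((L.isConfluent hb h2 h3).disjoint_normalWord (linearIndependent_mon_letter b)).mono_right
    fun _ hf => L.ker_lift_envι_le_relSpan hb h2 ((TwoSidedIdeal.mem_ker _).2 hf)

theorem linearIndependent_normalWord_env (h2 : (2 : k) ≠ 0) (h3 : (3 : k) ≠ 0) :
    LinearIndependent k fun w : {w // NormalWord (Defect ε deg) w} => mon (L.envι ∘ b) w.1 := by
  rw [← lift_envι_comp_letter]
  exact linearIndependent_mon_comp (linearIndependent_mon_letter b)
    (L.disjoint_span_normalWord_ker hb h2 h3)

theorem envι_injective (h2 : (2 : k) ≠ 0) (h3 : (3 : k) ≠ 0) : Function.Injective L.envι := by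
  refine (injective_iff_map_eq_zero _).2 fun v hv => (TensorAlgebra.ι_eq_zero_iff k v).1 ?_
  refine Submodule.disjoint_def.1 (L.disjoint_span_normalWord_ker hb h2 h3) _ ?_ ?_
  · refine Submodule.span_mono ?_ (ι_mem_span_mon_letter b v)
    rintro _ ⟨u, hu, rfl⟩
    obtain ⟨i, rfl⟩ := List.length_eq_one_iff.1 hu
    exact ⟨⟨[i], normalWord_singleton i⟩, rfl⟩
  · exact (TensorAlgebra.lift_ι_apply L.envι v).trans hv

theorem leadCoeff_smul_mon_env_sub_mem {i j : Fin n} (hD : Defect ε deg i j) :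
    leadCoeff k i j • mon (L.envι ∘ b) [i, j] - L.envι (L.bracket (b i) (b j)) ∈
      Submodule.span k (mon (L.envι ∘ b) '' {u | LexLT u [i, j]}) := by
  have image := Submodule.mem_map_of_mem (f := (TensorAlgebra.lift k L.envι).toLinearMap)
    (L.leadCoeff_smul_mon_sub_mem b hD)
  have rel_eq_zero : TensorAlgebra.lift k L.envι (L.letterRel b deg i j) = 0 :=
    L.lift_envι_commRel (hb i) (hb j)
  rw [Submodule.map_span, ← Set.image_comp, lift_envι_comp_mon_letter] at image
  simpa only [AlgHom.toLinearMap_apply, map_sub, map_smul, map_mon, lift_envι_comp_letter,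
    rel_eq_zero, sub_zero, TensorAlgebra.lift_ι_apply] using image

theorem mon_env_mem_span_wordLT (h2 : (2 : k) ≠ 0) {i j : Fin n} (hD : Defect ε deg i j) :
    mon (L.envι ∘ b) [i, j] ∈ Submodule.span k (mon (L.envι ∘ b) '' {u | WordLT u [i, j]}) := by
  have bracket_mem : L.envι (L.bracket (b i) (b j)) ∈
      Submodule.span k (mon (L.envι ∘ b) '' {u | WordLT u [i, j]}) := by
    rw [← b.sum_repr (L.bracket (b i) (b j)), map_sum]
    refine sum_mem fun l _ => ?_
    rw [map_smul]
    exact Submodule.smul_mem _ _ (Submodule.subset_span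
      ⟨[l], List.Shortlex.of_length_lt (by simp), by simp⟩)
  rw [← Submodule.smul_mem_iff _ (leadCoeff_ne_zero h2 i j),
    ← Submodule.sub_mem_iff_left _ bracket_mem]
  exact Submodule.span_mono (Set.image_mono fun u hu => hu.wordLT)
    (L.leadCoeff_smul_mon_env_sub_mem hb hD)

theorem mon_env_abelian_mem_span_lexLT (h2 : (2 : k) ≠ 0) {i j : Fin n} (hD : Defect ε deg i j) :
    mon (L.abelian.envι ∘ b) [i, j] ∈
      Submodule.span k (mon (L.abelian.envι ∘ b) '' {u | LexLT u [i, j]}) := by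
  rw [← Submodule.smul_mem_iff _ (leadCoeff_ne_zero h2 i j)]
  have straighten := L.abelian.leadCoeff_smul_mon_env_sub_mem hb hD
  have bracket_eq_zero : L.abelian.bracket (b i) (b j) = 0 := rfl
  rwa [bracket_eq_zero, map_zero, sub_zero] at straighten

theorem quadraticStraightening_abelian (h2 : (2 : k) ≠ 0) (h3 : (3 : k) ≠ 0) :
    QuadraticStraightening k (L.abelian.envι ∘ b) (Defect ε deg) where
  linearIndependent := L.abelian.linearIndependent_normalWord_env hb h2 h3
  span_eq_top := L.abelian.span_range_mon_env b
  straighten := mon_mem_span_normalWord isReductionOrder_lexLT fun _ _ hD =>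
    L.mon_env_abelian_mem_span_lexLT hb h2 hD

section FiniteDimensional

omit hb
variable [FiniteDimensional k g] (h2 : (2 : k) ≠ 0) (h3 : (3 : k) ≠ 0)
include h2 h3

theorem isAlmostQuadratic : IsAlmostQuadratic L.envι L.relations where
  finite := inferInstance
  gen_injective := by
    obtain ⟨n, b, deg, hb⟩ := L.exists_homogeneous_basis
    exact L.envι_injective hb h2 h3
  augmented := ⟨L.augmentation, L.ker_augmentation⟩
  rel_le := L.relations_le_tensorDeg
  surjective := L.lift_envι_surjective
  ker_eq := L.ker_lift_envι

theorem isPBW : IsPBW L.envι L.relations := by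
  obtain ⟨n, b, deg, hb⟩ := L.exists_homogeneous_basis
  obtain ⟨m, ⟨e⟩⟩ := Finite.exists_equiv_fin (RelIndex ε deg)
  let r := ((Module.Basis.span (L.linearIndependent_basisRel hb h2 h3)).map
    (LinearEquiv.ofEq _ _ (L.span_basisRel hb h2))).reindex e
  have r_apply : (fun i => (r i : TensorAlgebra k g)) = L.basisRel b deg ∘ e.symm :=
    funext fun i => by simp [r, Module.Basis.span_apply]
  refine ⟨L.isAlmostQuadratic h2 h3, n, m, b, r, ?_⟩
  rw [r_apply, EquivLike.range_comp]
  exact L.isGroebnerBasis hb h2 h3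

end FiniteDimensional

end ColorLieAlgebra

/-! ### Graded isomorphisms and symbols -/

section GradedIso

variable {k A B C V : Type*} [Field k] [Ring A] [Algebra k A] [Ring B] [Algebra k B]
  [Ring C] [Algebra k C] [AddCommGroup V] [Module k V]

section

variable {𝒜 : ℕ → Submodule k A} {ℬ : ℕ → Submodule k B} {𝒞 : ℕ → Submodule k C}
  {genA : V → A} {genB : V → B} {genC : V → C}

theorem GradedIso.symm (h : GradedIso 𝒜 ℬ genA genB) : GradedIso ℬ 𝒜 genB genA := by
  obtain ⟨e, map_gen, map_grading⟩ := h
  refine ⟨e.symm, fun v => by rw [← map_gen, e.symm_apply_apply], fun m => ?_⟩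
  rw [← map_grading, ← Submodule.map_comp]
  convert Submodule.map_id _
  ext y
  simp

theorem GradedIso.trans (h : GradedIso 𝒜 ℬ genA genB) (h' : GradedIso ℬ 𝒞 genB genC) :
    GradedIso 𝒜 𝒞 genA genC := by
  obtain ⟨e, map_gen, map_grading⟩ := h
  obtain ⟨e', map_gen', map_grading'⟩ := h'
  refine ⟨e.trans e', fun v => by simp only [AlgEquiv.trans_apply, map_gen, map_gen'], fun m => ?_⟩
  rw [← map_grading', ← map_grading, ← Submodule.map_comp]
  rfl

end

theorem map_genDeg {genA : V →ₗ[k] A} {genB : V →ₗ[k] B} {φ : A →ₐ[k] B}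
    (hφ : ∀ v, φ (genA v) = genB v) (m : ℕ) :
    (genDeg genA m).map φ.toLinearMap = genDeg genB m := by
  have comp_eq : φ.toLinearMap ∘ₗ genA = genB := LinearMap.ext hφ
  rw [genDeg, genDeg, Submodule.map_pow, ← LinearMap.range_comp, comp_eq]

theorem genDeg_eq_span_pow {X : Type*} {c : X → V} (hc : Submodule.span k (Set.range c) = ⊤)
    (gen : V →ₗ[k] A) (m : ℕ) : genDeg gen m = Submodule.span k (Set.range (gen ∘ c)) ^ m := by
  rw [genDeg, Set.range_comp, ← Submodule.map_span, hc, Submodule.map_top]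

theorem QuadraticStraightening.map {X : Type*} [LinearOrder X] {x : X → A} {D : X → X → Prop}
    (h : QuadraticStraightening k x D) (e : A ≃ₐ[k] B) : QuadraticStraightening k (e ∘ x) D := by
  have mon_eq : mon (e ∘ x) = e.toLinearMap ∘ mon x := funext fun w => (map_mon x e w).symm
  refine ⟨?_, ?_, fun w => ?_⟩
  · rw [mon_eq]
    exact h.linearIndependent.map' e.toLinearMap (LinearMap.ker_eq_bot.2 e.injective)
  · rw [mon_eq, Set.range_comp, ← Submodule.map_span, h.span_eq_top, Submodule.map_top,
      LinearMap.range_eq_top]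
    exact e.surjective
  · rw [mon_eq, Set.image_comp, ← Submodule.map_span]
    exact Submodule.mem_map_of_mem (h.straighten w)

end GradedIso

namespace GenFilt

variable {k A : Type*} [Field k] [Ring A] [Algebra k A] (W : Submodule k A)

/-- The symbol of degree `m` of an element of degree at most `m`: its class in the component of
degree `m` of the associated graded algebra, which is zero if the degree is less than `m`. -/
noncomputable def symbol (m : ℕ) : le W m →ₗ[k] Gr W :=
  DirectSum.lof k ℕ (Comp W) m ∘ₗ cls W m

variable {W}

theorem symbol_congr {i j : ℕ} (hij : i = j) {y : le W i} {z : le W j} (hyz : (y : A) = z) :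
    symbol W i y = symbol W j z := by
  subst hij
  rw [Subtype.ext hyz]

theorem symbol_mul_symbol {i j : ℕ} (y : le W i) (z : le W j) :
    symbol W i y * symbol W j z = symbol W (i + j) (mulRep W i j y z) :=
  DirectSum.of_mul_of _ _

theorem symbol_eq_zero {m : ℕ} {y : le W m} (hy : (y : A) ∈ lt W m) : symbol W m y = 0 := by
  rw [symbol, LinearMap.comp_apply, (cls_eq_zero W).2 hy, map_zero]

variable (W)

theorem range_symbol (m : ℕ) : LinearMap.range (symbol W m) = grading W m :=
  LinearMap.range_comp_of_range_eq_top _ (LinearMap.range_eq_top.2 (cls_surjective W m))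

theorem le_le_sup (m : ℕ) : le W m ≤ W ^ m ⊔ lt W m := by
  refine iSup₂_le fun j hj => ?_
  rcases hj.eq_or_lt with rfl | hj
  · exact le_sup_left
  · exact (pow_le_lt W hj).trans le_sup_right

theorem lt_span_range {X : Type*} (x : X → A) (m : ℕ) :
    lt (Submodule.span k (Set.range x)) m = Submodule.span k (mon x '' {w | w.length < m}) := by
  simp only [lt, span_range_pow]
  refine le_antisymm (iSup₂_le fun j hj => Submodule.span_mono (Set.image_mono ?_))
    (Submodule.span_le.2 ?_)
  · rintro w rfl
    exact hj
  · rintro _ ⟨w, hw, rfl⟩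
    exact Submodule.mem_iSup_of_mem w.length
      (Submodule.mem_iSup_of_mem hw (Submodule.subset_span ⟨w, rfl, rfl⟩))

theorem exists_dual_symbol {m : ℕ} {f : A →ₗ[k] k} (hf : ∀ y ∈ lt W m, f y = 0) :
    ∃ F : Gr W →ₗ[k] k, ∀ i (y : le W i), F (symbol W i y) = if i = m then f y else 0 := by
  let q : Comp W m →ₗ[k] k := Submodule.liftQ _ (f ∘ₗ (le W m).subtype) fun y hy => hf y hy
  refine ⟨q ∘ₗ DirectSum.component k ℕ _ m, fun i y => ?_⟩
  rw [symbol, LinearMap.comp_apply, LinearMap.comp_apply]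
  split_ifs with him
  · subst him
    rw [DirectSum.component.lof_self]
    rfl
  · rw [DirectSum.component.of, dif_neg him, map_zero]

end GenFilt

section AssocGr

open GenFilt

theorem exists_dual_eq_ite {ι k M : Type*} [DecidableEq ι] [Field k] [AddCommGroup M] [Module k M]
    {u : ι → M} (hu : LinearIndependent k u) (i : ι) :
    ∃ f : M →ₗ[k] k, ∀ j, f (u j) = if j = i then 1 else 0 := by
  obtain ⟨f, hf⟩ := LinearMap.exists_extend ((Module.Basis.span hu).coord i)
  refine ⟨f, fun j => ?_⟩
  simpa [Module.Basis.span_apply, Finsupp.single_apply] using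
    LinearMap.congr_fun hf (Module.Basis.span hu j)

variable {k A V : Type*} [Field k] [Ring A] [Algebra k A] [AddCommGroup V] [Module k V]
  (gen : V →ₗ[k] A)

theorem gen_mem_le_one (v : V) : gen v ∈ le (LinearMap.range gen) 1 :=
  pow_le_le _ le_rfl (by rw [pow_one]; exact LinearMap.mem_range_self gen v)

/-- The canonical map `V → gr A` of `assocGen`, as a linear map. -/
noncomputable def assocGenₗ : V →ₗ[k] AssocGr gen :=
  symbol (LinearMap.range gen) 1 ∘ₗ gen.codRestrict _ (gen_mem_le_one gen)

variable {X : Type*} {c : X → V}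

theorem mon_mem_le (w : List X) : mon (gen ∘ c) w ∈ le (LinearMap.range gen) w.length := by
  induction w with
  | nil => exact one_mem_le _ 0
  | cons i w ih =>
    rw [mon_cons, List.length_cons, add_comm]
    exact le_mul_le _ 1 w.length (Submodule.mul_mem_mul (gen_mem_le_one gen (c i)) ih)

theorem mon_assocGenₗ (w : List X) : mon (assocGenₗ gen ∘ c) w =
    symbol (LinearMap.range gen) w.length ⟨mon (gen ∘ c) w, mon_mem_le gen w⟩ := by
  induction w with
  | nil => rfl
  | cons i w ih =>
    rw [mon_cons, ih]
    refine (symbol_mul_symbol _ _).trans (symbol_congr ?_ ?_)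
    · rw [List.length_cons, add_comm]
    · exact (mon_cons (gen ∘ c) i w).symm

theorem genDeg_assocGenₗ_le (m : ℕ) : genDeg (assocGenₗ gen) m ≤ assocGrading gen m := by
  rw [genDeg_eq_span_pow (c := id) (by simp), span_range_pow]
  refine Submodule.span_le.2 ?_
  rintro _ ⟨w, rfl, rfl⟩
  rw [mon_assocGenₗ, assocGrading, ← range_symbol]
  exact LinearMap.mem_range_self _ _

theorem symbol_mem_genDeg_assocGenₗ {m : ℕ} {u : A} (hu : u ∈ LinearMap.range gen ^ m) :
    symbol (LinearMap.range gen) m ⟨u, pow_le_le _ le_rfl hu⟩ ∈ genDeg (assocGenₗ gen) m := by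
  have pow_le : LinearMap.range gen ^ m ≤
      ((genDeg (assocGenₗ gen) m).comap (symbol (LinearMap.range gen) m)).map
        (le (LinearMap.range gen) m).subtype := by
    rw [← genDeg, genDeg_eq_span_pow (c := id) (by simp), span_range_pow]
    refine Submodule.span_le.2 ?_
    rintro _ ⟨w, rfl, rfl⟩
    refine ⟨⟨_, mon_mem_le gen w⟩, ?_, rfl⟩
    rw [SetLike.mem_coe, Submodule.mem_comap, ← mon_assocGenₗ,
      genDeg_eq_span_pow (c := id) (by simp), span_range_pow]
    exact Submodule.subset_span ⟨w, rfl, rfl⟩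
  obtain ⟨y, hy, rfl⟩ := pow_le hu
  exact hy

theorem assocGrading_eq_genDeg : assocGrading gen = genDeg (assocGenₗ gen) := by
  refine funext fun m => le_antisymm ?_ (genDeg_assocGenₗ_le gen m)
  rw [assocGrading, ← range_symbol]
  rintro _ ⟨⟨y, hy⟩, rfl⟩
  obtain ⟨u, hu, v, hv, rfl⟩ := Submodule.mem_sup.1 (le_le_sup _ m hy)
  have symbol_eq : symbol (LinearMap.range gen) m ⟨u + v, hy⟩ =
      symbol (LinearMap.range gen) m ⟨u, pow_le_le _ le_rfl hu⟩ := by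
    rw [← sub_eq_zero, ← map_sub]
    exact symbol_eq_zero (by simpa using hv)
  rw [symbol_eq]
  exact symbol_mem_genDeg_assocGenₗ gen hu

theorem iSup_assocGrading : ⨆ m, assocGrading gen m = ⊤ := by
  refine eq_top_iff.2 fun y _ => ?_
  induction y using DirectSum.induction_on with
  | zero => exact zero_mem _
  | of m y => exact Submodule.mem_iSup_of_mem m (LinearMap.mem_range_self _ y)
  | add y z hy hz => exact add_mem (hy trivial) (hz trivial)

theorem linearIndependent_mon_assocGenₗ {P : List X → Prop}
    (hc : Submodule.span k (Set.range c) = ⊤)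
    (hli : LinearIndependent k fun w : {w // P w} => mon (gen ∘ c) w.1)
    (hspan : ∀ w, mon (gen ∘ c) w ∈
      Submodule.span k (mon (gen ∘ c) '' {v | P v ∧ v.length ≤ w.length})) :
    LinearIndependent k fun w : {w // P w} => mon (assocGenₗ gen ∘ c) w.1 := by
  classical
  have range_gen : LinearMap.range gen = Submodule.span k (Set.range (gen ∘ c)) := by
    simpa only [genDeg, pow_one] using genDeg_eq_span_pow hc gen 1
  have exists_coord (v : {w // P w}) : ∃ F : AssocGr gen →ₗ[k] k,
      ∀ w : {w // P w}, F (mon (assocGenₗ gen ∘ c) w.1) = if w = v then 1 else 0 := by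
    obtain ⟨f, hf⟩ := exists_dual_eq_ite hli v
    have f_lt : ∀ y ∈ lt (LinearMap.range gen) v.1.length, f y = 0 := by
      rw [range_gen, lt_span_range]
      refine fun y hy => (Submodule.span_le (p := LinearMap.ker f)).2 ?_ hy
      rintro _ ⟨w, hw, rfl⟩
      refine (Submodule.span_le (p := LinearMap.ker f)).2 ?_ (hspan w)
      rintro _ ⟨u, ⟨hu, huw⟩, rfl⟩
      refine (hf ⟨u, hu⟩).trans (if_neg ?_)
      rintro rfl
      exact huw.not_gt hw
    obtain ⟨F, hF⟩ := exists_dual_symbol _ f_lt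
    refine ⟨F, fun w => ?_⟩
    rw [mon_assocGenₗ, hF, hf, ← ite_and]
    exact if_congr ⟨And.right, fun hwv => ⟨hwv ▸ rfl, hwv⟩⟩ rfl rfl
  choose F hF using exists_coord
  exact LinearIndependent.of_pairwise_dual_eq_zero_one _ F
    (fun v w hvw => (hF v w).trans (if_neg hvw.symm)) fun v => (hF v v).trans (if_pos rfl)

end AssocGr

/-! ### Comparison with the abelian color Lie algebra -/

namespace ColorLieAlgebra

open TensorAlgebra

variable {k Γ : Type*} [Field k] [AddCommGroup Γ] {ε : CommutationFactor k Γ}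
  {g : Type*} [AddCommGroup g] [Module k g] (L : ColorLieAlgebra ε g)

theorem commRel_abelian (α β : Γ) (a b : g) :
    L.abelian.commRel α β a b = L.commRel α β a b + ι k (L.bracket a b) := by
  simp [commRel, abelian]

theorem commRel_abelian_mem_tensorDeg (α β : Γ) (a b : g) :
    L.abelian.commRel α β a b ∈ tensorDeg k g 2 := by
  rw [commRel_abelian, commRel, sub_add_cancel]
  exact ι_mul_ι_sub_smul_mem_tensorDeg a b _

theorem relations_abelian_le_tensorDeg : L.abelian.relations ≤ tensorDeg k g 2 := by
  refine Submodule.span_le.2 ?_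
  rintro _ ⟨α, β, a, -, b, -, rfl⟩
  exact L.commRel_abelian_mem_tensorDeg α β a b

theorem relations_le_abelian_sup : L.relations ≤ L.abelian.relations ⊔ tensorDeg k g 1 := by
  refine Submodule.span_le.2 ?_
  rintro _ ⟨α, β, a, ha, b, hb, rfl⟩
  rw [← add_sub_cancel_right (L.commRel α β a b) (ι k (L.bracket a b)), ← commRel_abelian]
  exact sub_mem (Submodule.mem_sup_left (L.abelian.commRel_mem_relations ha hb))
    (Submodule.mem_sup_right (ι_mem_tensorDeg _))

theorem disjoint_tensorDeg {i j : ℕ} (hij : i ≠ j) :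
    Disjoint (tensorDeg k g i) (tensorDeg k g j) :=
  (DirectSum.Decomposition.isInternal (tensorDeg k g)).submodule_iSupIndep.pairwiseDisjoint hij

theorem quadRel_commRel_abelian {α β : Γ} {a b : g} (ha : a ∈ L.comp α) (hb : b ∈ L.comp β) :
    quadRel L.relations (L.abelian.commRel α β a b) 0 := by
  refine ⟨L.commRel_abelian_mem_tensorDeg α β a b,
    ⟨-ι k (L.bracket a b), neg_mem (ι_mem_tensorDeg _), ?_⟩, rfl⟩
  rw [commRel_abelian, add_neg_cancel_right]
  exact L.commRel_mem_relations ha hb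

theorem mem_relations_abelian_of_quadRel {y z : TensorAlgebra k g}
    (h : quadRel L.relations y z) : y ∈ L.abelian.relations := by
  obtain ⟨hy, ⟨l, hl, hyl⟩, -⟩ := h
  obtain ⟨r, hr, l', hl', hrl⟩ := Submodule.mem_sup.1 (L.relations_le_abelian_sup hyl)
  have diff_eq : y - r = l' - l := sub_eq_sub_iff_add_eq_add.2 (hrl.symm.trans (add_comm r l'))
  have diff_eq_zero : y - r = 0 := by
    refine Submodule.disjoint_def.1 (disjoint_tensorDeg (by decide : 2 ≠ 1)) _
      (sub_mem hy (L.relations_abelian_le_tensorDeg hr)) ?_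
    rw [diff_eq]
    exact sub_mem hl' hl
  rwa [sub_eq_zero.1 diff_eq_zero]

/-- The canonical homomorphism from the homogeneous quadratic algebra of `U(g)` to the enveloping
algebra of the abelian color Lie algebra. -/
noncomputable def quadAlgToAbelian : QuadAlg L.relations →ₐ[k] L.abelian.Env :=
  RingQuot.liftAlgHom k ⟨TensorAlgebra.lift k L.abelian.envι, fun y z h => by
    have y_mem := TwoSidedIdeal.subset_span (L.mem_relations_abelian_of_quadRel h)
    rw [← ker_lift_envι, SetLike.mem_coe, TwoSidedIdeal.mem_ker] at y_mem
    rw [y_mem, h.2.2, map_zero]⟩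

theorem quadAlgToAbelian_quadGen (v : g) :
    L.quadAlgToAbelian (quadGen L.relations v) = L.abelian.envι v :=
  (RingQuot.liftAlgHom_mkAlgHom_apply k _ _ _).trans (TensorAlgebra.lift_ι_apply _ v)

theorem quadGen_comm {α β : Γ} {a b : g} (ha : a ∈ L.comp α) (hb : b ∈ L.comp β) :
    quadGen L.relations a * quadGen L.relations b =
      (ε α β : k) • (quadGen L.relations b * quadGen L.relations a) := by
  have commRel_eq_zero := RingQuot.mkAlgHom_rel k (L.quadRel_commRel_abelian ha hb)
  have bracket_eq_zero : L.abelian.bracket a b = 0 := rfl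
  rwa [map_zero, commRel, bracket_eq_zero, map_zero, sub_zero, map_sub, map_smul, map_mul, map_mul,
    sub_eq_zero] at commRel_eq_zero

/-- The canonical homomorphism from the enveloping algebra of the abelian color Lie algebra to the
homogeneous quadratic algebra of `U(g)`. -/
noncomputable def abelianToQuadAlg : L.abelian.Env →ₐ[k] QuadAlg L.relations :=
  L.abelian.envLift (quadGen L.relations) fun _ _ _ _ ha hb =>
    (L.quadGen_comm ha hb).trans (by simp [abelian])

theorem gradedIso_quadAlg : GradedIso (genDeg (quadGen L.relations)) (genDeg L.abelian.envι)
    (quadGen L.relations) L.abelian.envι := by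
  have inverse_quadGen (v : g) :
      L.abelianToQuadAlg (L.quadAlgToAbelian (quadGen L.relations v)) = quadGen L.relations v := by
    rw [quadAlgToAbelian_quadGen, abelianToQuadAlg, envLift_envι]
  have inverse_envι (v : g) :
      L.quadAlgToAbelian (L.abelianToQuadAlg (L.abelian.envι v)) = L.abelian.envι v := by
    rw [abelianToQuadAlg, envLift_envι, quadAlgToAbelian_quadGen]
  refine ⟨AlgEquiv.ofAlgHom L.quadAlgToAbelian L.abelianToQuadAlg (env_algHom_ext inverse_envι)
    (RingQuot.ringQuot_ext' k _ _ (TensorAlgebra.hom_ext (LinearMap.ext inverse_quadGen))),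
    L.quadAlgToAbelian_quadGen, map_genDeg L.quadAlgToAbelian_quadGen⟩

theorem assocGenₗ_comm {α β : Γ} {a b : g} (ha : a ∈ L.comp α) (hb : b ∈ L.comp β) :
    assocGenₗ L.envι a * assocGenₗ L.envι b =
      (ε α β : k) • (assocGenₗ L.envι b * assocGenₗ L.envι a) := by
  have comm := L.lift_envι_commRel ha hb
  simp only [commRel, map_sub, map_smul, map_mul, TensorAlgebra.lift_ι_apply] at comm
  rw [← sub_eq_zero]
  simp only [assocGenₗ, LinearMap.comp_apply]
  rw [GenFilt.symbol_mul_symbol, GenFilt.symbol_mul_symbol, ← map_smul, ← map_sub]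
  refine GenFilt.symbol_eq_zero ?_
  have bracket_mem : L.envι (L.bracket a b) ∈ GenFilt.lt (LinearMap.range L.envι) (1 + 1) :=
    GenFilt.pow_le_lt _ one_lt_two (by rw [pow_one]; exact LinearMap.mem_range_self _ _)
  rw [← sub_eq_zero.1 comm] at bracket_mem
  exact bracket_mem

/-- The canonical homomorphism from the enveloping algebra of the abelian color Lie algebra to
`gr U(g)`. -/
noncomputable def abelianToAssocGr : L.abelian.Env →ₐ[k] AssocGr L.envι :=
  L.abelian.envLift (assocGenₗ L.envι) fun _ _ _ _ ha hb =>
    (L.assocGenₗ_comm ha hb).trans (by simp [abelian])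

theorem abelianToAssocGr_envι (v : g) :
    L.abelianToAssocGr (L.abelian.envι v) = assocGenₗ L.envι v :=
  envLift_envι _ v

theorem map_abelianToAssocGr_genDeg (m : ℕ) :
    (genDeg L.abelian.envι m).map L.abelianToAssocGr.toLinearMap = assocGrading L.envι m := by
  rw [map_genDeg L.abelianToAssocGr_envι, assocGrading_eq_genDeg]

theorem abelianToAssocGr_surjective : Function.Surjective L.abelianToAssocGr := by
  refine LinearMap.range_eq_top (f := L.abelianToAssocGr.toLinearMap).1 (eq_top_iff.2 ?_)
  rw [← iSup_assocGrading]
  refine iSup_le fun m => ?_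
  rw [← map_abelianToAssocGr_genDeg]
  exact LinearMap.map_le_range

variable {n : ℕ} {b : Module.Basis (Fin n) k g} {deg : Fin n → Γ}
  (hb : ∀ i, b i ∈ L.comp (deg i)) (h2 : (2 : k) ≠ 0) (h3 : (3 : k) ≠ 0)
include hb h2

theorem mon_env_mem_span_normalWord_length_le (w : List (Fin n)) :
    mon (L.envι ∘ b) w ∈ Submodule.span k
      (mon (L.envι ∘ b) '' {v | NormalWord (Defect ε deg) v ∧ v.length ≤ w.length}) := by
  refine Submodule.span_mono (Set.image_mono ?_) (mon_mem_span_normalWord isReductionOrder_wordLT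
    (fun _ _ hD => L.mon_env_mem_span_wordLT hb h2 hD) w)
  rintro v ⟨hv, rfl | hvw⟩
  · exact ⟨hv, le_rfl⟩
  · exact ⟨hv, hvw.length_le⟩

include h3

theorem abelianToAssocGr_injective : Function.Injective L.abelianToAssocGr := by
  let normalBasis := (L.quadraticStraightening_abelian hb h2 h3).basis
  have image_basis : L.abelianToAssocGr.toLinearMap ∘ normalBasis =
      fun w => mon (assocGenₗ L.envι ∘ b) w.1 := by
    have comp_eq : L.abelianToAssocGr ∘ (L.abelian.envι ∘ b) = assocGenₗ L.envι ∘ b :=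
      funext fun i => L.abelianToAssocGr_envι (b i)
    funext w
    rw [Function.comp_apply, QuadraticStraightening.basis_apply, AlgHom.toLinearMap_apply, map_mon,
      comp_eq]
  refine LinearMap.injective_of_linearIndependent (f := L.abelianToAssocGr.toLinearMap)
    normalBasis.span_eq ?_
  rw [image_basis]
  exact linearIndependent_mon_assocGenₗ L.envι b.span_eq
    (L.linearIndependent_normalWord_env hb h2 h3) (L.mon_env_mem_span_normalWord_length_le hb h2)

theorem gradedIso_assocGr : GradedIso (genDeg L.abelian.envι) (assocGrading L.envι)
    L.abelian.envι (assocGen L.envι) :=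
  ⟨AlgEquiv.ofBijective L.abelianToAssocGr
    ⟨L.abelianToAssocGr_injective hb h2 h3, L.abelianToAssocGr_surjective⟩,
    L.abelianToAssocGr_envι, L.map_abelianToAssocGr_genDeg⟩

theorem isHomogeneousKoszul_of_gradedIso {A : Type*} [Ring A] [Algebra k A]
    {𝒜 : ℕ → Submodule k A} {gen : g → A}
    (h : GradedIso (genDeg L.abelian.envι) 𝒜 L.abelian.envι gen) : IsHomogeneousKoszul 𝒜 := by
  obtain ⟨e, -, map_grading⟩ := h
  have grading_eq : 𝒜 = fun m => Submodule.span k (Set.range (e ∘ (L.abelian.envι ∘ b))) ^ m :=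
    funext fun m => (map_grading m).symm.trans <|
      (map_genDeg (φ := (e : L.abelian.Env →ₐ[k] A)) (genB := e.toLinearMap ∘ₗ L.abelian.envι)
        (fun _ => rfl) m).trans (genDeg_eq_span_pow b.span_eq _ m)
  rw [grading_eq]
  exact ((L.quadraticStraightening_abelian hb h2 h3).map e).isHomogeneousKoszul

end ColorLieAlgebra

theorem mainTheorem2 {k : Type*} [Field k] (h2 : (2 : k) ≠ 0) (h3 : (3 : k) ≠ 0)
    {Γ : Type*} [AddCommGroup Γ] (ε : CommutationFactor k Γ)
    {g : Type*} [AddCommGroup g] [Module k g] [FiniteDimensional k g]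
    (L : ColorLieAlgebra ε g) :
    IsAlmostQuadratic L.envι L.relations ∧
    IsPBW L.envι L.relations ∧
    (∀ (n : ℕ) (b : Module.Basis (Fin n) k g) (deg : Fin n → Γ),
      (∀ i, b i ∈ L.comp (deg i)) →
        LinearIndependent k (L.basisRel b deg) ∧
        Submodule.span k (Set.range (L.basisRel b deg)) = L.relations ∧
        IsGroebnerBasis b (Set.range (L.basisRel b deg))
          (TwoSidedIdeal.ker (TensorAlgebra.lift k L.envι))) ∧
    IsKoszulAlmostQuadratic L.envι L.relations ∧
    GradedIso (assocGrading L.envι) (genDeg L.abelian.envι)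
      (assocGen L.envι) L.abelian.envι ∧
    GradedIso (genDeg (quadGen L.relations)) (genDeg L.abelian.envι)
      (quadGen L.relations) L.abelian.envι := by
  obtain ⟨n, b, deg, hb⟩ := L.exists_homogeneous_basis
  have iso_gr := L.gradedIso_assocGr hb h2 h3
  have iso_quad := L.gradedIso_quadAlg
  exact ⟨L.isAlmostQuadratic h2 h3, L.isPBW h2 h3,
    fun n b deg hb => ⟨L.linearIndependent_basisRel hb h2 h3, L.span_basisRel hb h2,
      L.isGroebnerBasis hb h2 h3⟩,
    ⟨L.isAlmostQuadratic h2 h3, iso_quad.trans iso_gr,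
      L.isHomogeneousKoszul_of_gradedIso hb h2 h3 iso_quad.symm,
      L.isHomogeneousKoszul_of_gradedIso hb h2 h3 iso_gr⟩,
    iso_gr.symm, iso_quad⟩
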